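/- Conventions. A compact matrix quantum group (CMQG) of size $N$ is a pair $G=(C(G),u)$ of a unital C*-algebra $C(G)$ and a matrix $u\in M_N(C(G))$ whose entries generate $C(G)$, such that $u$ and $u^t$ are invertible and $u_{ij}\mapsto\sum_k u_{ik}\otimes u_{kj}$ extends to a unital $*$-homomorphism $C(G)\to C(G)\otimes_{\min}C(G)$. One writes $H\subset G$, for $H=(C(H),v)$ of the same size, if there is a surjective $*$-homomorphism $C(G)\to C(H)$ with $u_{ij}\mapsto v_{ij}$. Put $\mathrm{Mor}(u^{\otimes k},u^{\otimes l})=\{T\in\mathcal L((\mathbb C^N)^{\otimes k},(\mathbb C^N)^{\otimes l})\mid Tu^{\otimes k}=u^{\otimes l}T\}$. $O_N^+$ is given by the universal unital C*-algebra with generators $u_{ij}=u_{ij}^*$ and relations $uu^t=u^tu=1$; $B_N^{\#+}$ by the same generators and relations together with $\big(\sum_a u_{ia}\big)\big(\sum_b u_{jb}\big)=1$ for all $i,j$; $S_N$ is the group of permutation matrices. Let $\mathscr P_{N\text{-lin}}(k,l)$ be the complex vector space with basis the set of partitions $p$ of $k$ upper and $l$ lower points. It carries the tensor product (diagrams side by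 side), the composition (vertical concatenation, with a factor $N$ for each connected component of middle points that is attached to no upper or lower point) and the antilinear involution (reflection at the horizontal axis). For a partition $p$ let $T_p\colon(\mathbb C^N)^{\otimes k}\to(\mathbb C^N)^{\otimes l}$ have matrix entries $\delta_p(\mathbf i,\mathbf j)$, equal to $1$ if points in the same block of $p$ carry the same index, and $0$ otherwise; extend linearly. A linear category of partitions is a family of subspaces $\mathscr K(k,l)\subset\mathscr P_{N\text{-lin}}(k,l)$ that contains the identity partition in $\mathscr K(1,1)$ and the pair partition in $\mathscr K(0,2)$ and is closed under these operations. $G$ corresponds to $\mathscr K$ if $\mathrm{Mor}(u^{\otimes k},u^{\otimes l})=\{T_p\mid p\in\mathscr K(k,l)\}$ for all $k,l\ge0$. Let $\uparrow\otimes\uparrow$ be the partition of two lower points into two singletons. Let $N\ge2$, fix a sign $\pm$, and put $d=\pm\frac1{\sqrt N}$, $c=-\frac1{N-1}\big(1\pm\frac1{\sqrt N}\big)$. Let $V=V_{(N,\pm)}$ be the $(N-1)\times N$ matrix with $V_{ij}=\delta_{ij}+c$ for $j<N$ and $V_{iN}=d$. For a partition $p\in\mathscr P(k,l)$ and a set $I$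 of its points let $p_I$ be the partition made from $p$ by turning every point of $I$ into a singleton. Define the linear map $\mathcal V_{(N,\pm)}\colon\mathscr P_{N\text{-lin}}(k,l)\to\mathscr P_{(N-1)\text{-lin}}(k,l)$ by $$\mathcal V_{(N,\pm)}p=\sum_{I}\Big(\prod_{B\text{ block of }p}w_B(I)\Big)p_I,\qquad w_B(I)=\begin{cases}c^{|I\cap B|}&\text{if }B\not\subset I,\\(N-1)c^{|B|}+d^{|B|}&\text{if }B\subset I.\end{cases}$$ For a CMQG $G=(C(G),u)$ with $S_N\subset G\subset B_N^{\#+}$ let $G^{\rm irr}_\pm=V G V^*$ be the pair $(A,v)$, where $v=VuV^*\in M_{N-1}(C(G))$ and $A$ is the C*-subalgebra of $C(G)$ generated by the entries of $v$. **Theorem.** Let $G=(C(G),u)$ be a CMQG with $S_N\subset G\subset B_N^{\#+}$, $N\ge2$. Then: 1. $G^{\rm irr}_\pm$ is a compact matrix quantum group, and $S_{N-1}\subset(S_N)^{\rm irr}_\pm\subset G^{\rm irr}_\pm\subset O_{N-1}^+$. 2. $T_{\mathcal V_{(N,\pm)}p}=V_{(N,\pm)}^{\otimes l}\,T_p\,V_{(N,\pm)}^{*\otimes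 k}$ for all $k,l\ge0$ and all $p\in\mathscr P_{N\text{-lin}}(k,l)$. 3. If $G$ corresponds to a linear category of partitions $\mathscr K\subset\mathscr P_{N\text{-lin}}$ with $\uparrow\otimes\uparrow\in\mathscr K$, then $\mathcal V_{(N,\pm)}\mathscr K=\{\mathcal V_{(N,\pm)}p\mid p\in\mathscr K\}\subset\mathscr P_{(N-1)\text{-lin}}$ is a linear category of partitions and $G^{\rm irr}_\pm$ corresponds to it: $\mathrm{Mor}(v^{\otimes k},v^{\otimes l})=\{T_q\mid q\in\mathcal V_{(N,\pm)}\mathscr K(k,l)\}$ for all $k,l\ge0$. -/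

import Mathlib

open scoped Matrix TensorProduct ENNReal

universe u w

noncomputable section

namespace PartQG

/-! ### Partitions and their formal linear combinations -/

/-- A partition of `k` upper and `l` lower points, given by its equivalence relation
"lies in the same block". -/
abbrev Part (k l : ℕ) : Type := Setoid (Fin k ⊕ Fin l)

/-- Formal complex linear combinations of partitions of `k` upper and `l` lower points. -/
abbrev PLin (k l : ℕ) : Type := Part k l →₀ ℂ

/-- The disjoint union of two equivalence relations. -/
@[reducible]
def sumSetoid {α β : Type} (p : Setoid α) (q : Setoid β) : Setoid (α ⊕ β) where
  r := Sum.LiftRel p q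
  iseqv :=
    { refl := by
        rintro (a | b)
        · exact Sum.LiftRel.inl (p.refl a)
        · exact Sum.LiftRel.inr (q.refl b)
      symm := by
        rintro _ _ (h | h)
        · exact Sum.LiftRel.inl (p.symm h)
        · exact Sum.LiftRel.inr (q.symm h)
      trans := by
        rintro _ _ _ (h | h) (h' | h')
        · exact Sum.LiftRel.inl (p.trans h h')
        · exact Sum.LiftRel.inr (q.trans h h') }

/-- The partition `p ⊗ q`: the diagrams of `p` and `q` side by side. -/
@[reducible]
def Part.tensor {k l k' l' : ℕ} (p : Part k l) (q : Part k' l') :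
    Part (k + k') (l + l') :=
  (sumSetoid p q).comap fun x =>
    Equiv.sumSumSumComm (Fin k) (Fin k') (Fin l) (Fin l')
      (Sum.map finSumFinEquiv.symm finSumFinEquiv.symm x)

/-- The diagram of `q` below the diagram of `p`, as a partition of `k` upper, `l` middle and
`m` lower points: the smallest equivalence relation that joins the blocks of `p` and of `q`. -/
@[reducible]
def Part.glue {k l m : ℕ} (q : Part l m) (p : Part k l) : Setoid (Fin k ⊕ (Fin l ⊕ Fin m)) :=
  Relation.EqvGen.setoid fun x y =>
    (∃ a b, p a b ∧ x = Sum.map id Sum.inl a ∧ y = Sum.map id Sum.inl b) ∨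
      (∃ a b, q a b ∧ x = Sum.inr a ∧ y = Sum.inr b)

/-- The partition underlying the composition `q p`. -/
@[reducible]
def Part.comp {k l m : ℕ} (q : Part l m) (p : Part k l) : Part k m :=
  (Part.glue q p).comap (Sum.map id Sum.inr)

/-- The number of connected components in the middle of the diagram of `q p` that are connected
neither to an upper nor to a lower point. -/
def Part.loops {k l m : ℕ} (q : Part l m) (p : Part k l) : ℕ :=
  Nat.card {c : Quotient (Part.glue q p) //
    ∀ x : Fin k ⊕ Fin m, Quotient.mk (Part.glue q p) (Sum.map id Sum.inr x) ≠ c}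

/-- The partition `p^*`: the diagram of `p` upside down. -/
@[reducible]
def Part.invol {k l : ℕ} (p : Part k l) : Part l k := p.comap Sum.swap

/-- Tensor product of linear combinations of partitions. -/
def tensorLin {k l k' l' : ℕ} (p : PLin k l) (q : PLin k' l') : PLin (k + k') (l + l') :=
  p.sum fun a x => q.sum fun b y => Finsupp.single (Part.tensor a b) (x * y)

/-- Composition `q p` of linear combinations of partitions, with a factor `N` for each
removed component. -/
def compLin (N : ℕ) {k l m : ℕ} (q : PLin l m) (p : PLin k l) : PLin k m :=
  q.sum fun b y => p.sum fun a x =>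
    Finsupp.single (Part.comp b a) (y * x * (N : ℂ) ^ Part.loops b a)

/-- The (antilinear) involution on linear combinations of partitions. -/
def involLin {k l : ℕ} (p : PLin k l) : PLin l k :=
  p.sum fun a x => Finsupp.single (Part.invol a) (star x)

/-- The identity partition, with one upper and one lower point in one block. -/
def idPart : PLin 1 1 := Finsupp.single ⊤ 1

/-- The pair partition, with two lower points in one block. -/
def pairPart : PLin 0 2 := Finsupp.single ⊤ 1

/-- The double singleton `↑ ⊗ ↑`, with two lower points in two different blocks. -/
def doubleSingleton : PLin 0 2 := Finsupp.single ⊥ 1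

/-- Linear categories of partitions inside the linear combinations of partitions with
parameter `N`. -/
structure IsLinCat (N : ℕ) (K : ∀ k l : ℕ, Submodule ℂ (PLin k l)) : Prop where
  id_mem : idPart ∈ K 1 1
  pair_mem : pairPart ∈ K 0 2
  tensor_mem : ∀ {k l k' l' : ℕ} (p : PLin k l) (q : PLin k' l'),
    p ∈ K k l → q ∈ K k' l' → tensorLin p q ∈ K (k + k') (l + l')
  comp_mem : ∀ {k l m : ℕ} (q : PLin l m) (p : PLin k l),
    q ∈ K l m → p ∈ K k l → compLin N q p ∈ K k m
  invol_mem : ∀ {k l : ℕ} (p : PLin k l), p ∈ K k l → involLin p ∈ K l k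

open Classical in
/-- The matrix of `T_p : (ℂ^N)^{⊗k} → (ℂ^N)^{⊗l}` in the standard bases, for a partition `p`. -/
def partMatrix (N : ℕ) {k l : ℕ} (p : Part k l) :
    Matrix (Fin l → Fin N) (Fin k → Fin N) ℂ :=
  Matrix.of fun j i => if ∀ x y, p x y → Sum.elim i j x = Sum.elim i j y then 1 else 0

/-- The matrix of `T_p`, for a linear combination `p` of partitions. -/
def T (N : ℕ) {k l : ℕ} : PLin k l →ₗ[ℂ] Matrix (Fin l → Fin N) (Fin k → Fin N) ℂ :=
  Finsupp.linearCombination ℂ (partMatrix N)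

/-! ### Matrices over C*-algebras -/

/-- The `k`-th tensor power of a matrix `u`, with entries
`u_{i_1 j_1} u_{i_2 j_2} ⋯ u_{i_k j_k}`. -/
def tpow {A : Type*} [Semiring A] {ι κ : Type*} (u : Matrix ι κ A) (k : ℕ) :
    Matrix (Fin k → ι) (Fin k → κ) A :=
  Matrix.of fun i j => (List.ofFn fun a => u (i a) (j a)).prod

/-- A scalar matrix, as a matrix over the algebra `A`. -/
def scal (A : Type*) [Semiring A] [Algebra ℂ A] {ι κ : Type*} (M : Matrix ι κ ℂ) :
    Matrix ι κ A :=
  M.map (algebraMap ℂ A)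

/-- `Mor(u^{⊗k}, u^{⊗l})`, the set of all `T` with `T u^{⊗k} = u^{⊗l} T`. -/
def Mor {A : Type*} [Semiring A] [Algebra ℂ A] {N : ℕ} (u : Matrix (Fin N) (Fin N) A)
    (k l : ℕ) : Set (Matrix (Fin l → Fin N) (Fin k → Fin N) ℂ) :=
  {S | scal A S * tpow u k = tpow u l * scal A S}

/-- `(A, u)` corresponds to `K`: `Mor(u^{⊗k}, u^{⊗l}) = {T_p | p ∈ K(k,l)}` for all `k`, `l`. -/
def Corresponds {A : Type*} [Semiring A] [Algebra ℂ A] {N : ℕ} (u : Matrix (Fin N) (Fin N) A)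
    (K : ∀ k l : ℕ, Submodule ℂ (PLin k l)) : Prop :=
  ∀ k l : ℕ, Mor u k l = {S | ∃ p ∈ K k l, T N p = S}

/-- The unital C*-subalgebra generated by the entries of a matrix. -/
def gen {A : Type u} [CStarAlgebra A] {N : ℕ} (u : Matrix (Fin N) (Fin N) A) :
    StarSubalgebra ℂ A :=
  (StarAlgebra.adjoin ℂ (Set.range fun x : Fin N × Fin N => u x.1 x.2)).topologicalClosure

instance {A : Type u} [CStarAlgebra A] {N : ℕ} (u : Matrix (Fin N) (Fin N) A) :
    IsClosed (gen u : Set A) :=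
  StarSubalgebra.isClosed_topologicalClosure _

theorem mem_gen {A : Type u} [CStarAlgebra A] {N : ℕ} (u : Matrix (Fin N) (Fin N) A)
    (i j : Fin N) : u i j ∈ gen u :=
  StarSubalgebra.le_topologicalClosure _ (StarAlgebra.subset_adjoin ℂ _ ⟨(i, j), rfl⟩)

/-- A matrix, as a matrix over the C*-algebra generated by its entries. -/
def restr {A : Type u} [CStarAlgebra A] {N : ℕ} (u : Matrix (Fin N) (Fin N) A) :
    Matrix (Fin N) (Fin N) (gen u) :=
  Matrix.of fun i j => ⟨u i j, mem_gen u i j⟩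

/-! ### Compact matrix quantum groups -/

/-- The Hilbert space tensor product `H ⊗ H`. -/
abbrev Hilb2 (H : Type u) [NormedAddCommGroup H] [InnerProductSpace ℂ H] : Type u :=
  UniformSpace.Completion (H ⊗[ℂ] H)

/-- `(A, u)` is a compact matrix quantum group.

In `comul`, the minimal (spatial) tensor product `A ⊗_min A` is the closure of `π(A) ⊙ π(A)` in
`B(H ⊗ H)`, where `π` is a faithful unital representation of `A` on a Hilbert space `H` (it does
not depend on the choice of `π`). The operators `Δ(u_{ij}) = ∑_k π(u_{ik}) ⊗ π(u_{kj})` are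
described by their values on elementary tensors. As they lie in `π(A) ⊙ π(A)` and the `u_{ij}`
generate `A`, the image of `Δ` lies in `A ⊗_min A`. -/
structure IsCMQG {A : Type u} [CStarAlgebra A] {N : ℕ} (u : Matrix (Fin N) (Fin N) A) :
    Prop where
  generates : gen u = ⊤
  isUnit : IsUnit u
  isUnit_transpose : IsUnit uᵀ
  comul : ∃ (H : Type u) (_ : NormedAddCommGroup H) (_ : InnerProductSpace ℂ H)
    (_ : CompleteSpace H) (π : A →⋆ₐ[ℂ] (H →L[ℂ] H)) (Δ : A →⋆ₐ[ℂ] (Hilb2 H →L[ℂ] Hilb2 H)),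
    Function.Injective π ∧
    ∀ (i j : Fin N) (x y : H),
      Δ (u i j) ((x ⊗ₜ[ℂ] y : H ⊗[ℂ] H) : Hilb2 H) =
        ((∑ k, (π (u i k) x) ⊗ₜ[ℂ] (π (u k j) y) : H ⊗[ℂ] H) : Hilb2 H)

/-- `(B, v) ⊆ (A, u)`: there is a surjective `*`-homomorphism `A → B` with `u_{ij} ↦ v_{ij}`. -/
def QSub {A : Type u} [CStarAlgebra A] {B : Type w} [CStarAlgebra B] {N : ℕ}
    (v : Matrix (Fin N) (Fin N) B) (u : Matrix (Fin N) (Fin N) A) : Prop :=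
  ∃ φ : A →⋆ₐ[ℂ] B, Function.Surjective φ ∧ ∀ i j, φ (u i j) = v i j

/-- The symmetric group `S_N`: the functions `u_{ij}` that send a permutation to the entries of
its permutation matrix, in the algebra of functions on the finite group. -/
def symm (N : ℕ) : Matrix (Fin N) (Fin N) (Equiv.Perm (Fin N) → ℂ) :=
  Matrix.of fun i j σ => if i = σ j then 1 else 0

/-- Nonzero unital C*-algebras with a matrix `u` such that `u = ū`, `u u^t = u^t u = 1`, and
`T_p u^{⊗k} = u^{⊗l} T_p` for all `p` in a given collection. -/
structure OrthRep (N : ℕ) (R : ∀ k l : ℕ, Set (PLin k l)) : Type (u + 1) where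
  carrier : Type u
  [cstar : CStarAlgebra carrier]
  [nontriv : Nontrivial carrier]
  mat : Matrix (Fin N) (Fin N) carrier
  star_mat : ∀ i j, star (mat i j) = mat i j
  mul_transpose : mat * matᵀ = 1
  transpose_mul : matᵀ * mat = 1
  rel : ∀ (k l : ℕ), ∀ p ∈ R k l, T N p ∈ Mor mat k l

attribute [instance] OrthRep.cstar OrthRep.nontriv

theorem OrthRep.norm_le {N : ℕ} {R : ∀ k l : ℕ, Set (PLin k l)} (ρ : OrthRep.{u} N R)
    (i j : Fin N) : ‖ρ.mat i j‖ ≤ 1 := by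
  let _ := CStarAlgebra.spectralOrder ρ.carrier
  have _ := CStarAlgebra.spectralOrderedRing ρ.carrier
  have h1 : ∑ k, star (ρ.mat i k) * ρ.mat i k = 1 := by
    have := congrFun (congrFun ρ.mul_transpose i) i
    simpa [Matrix.mul_apply, ρ.star_mat] using this
  have h2 : star (ρ.mat i j) * ρ.mat i j ≤ 1 := by
    rw [← h1]
    exact Finset.single_le_sum (f := fun k => star (ρ.mat i k) * ρ.mat i k)
      (fun k _ => star_mul_self_nonneg _) (Finset.mem_univ j)
  have h3 := CStarAlgebra.norm_le_norm_of_nonneg_of_le (star_mul_self_nonneg _) h2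
  rw [CStarRing.norm_star_mul_self, norm_one] at h3
  nlinarith [norm_nonneg (ρ.mat i j)]

instance (N : ℕ) (R : ∀ k l : ℕ, Set (PLin k l)) :
    CStarAlgebra (lp (fun ρ : OrthRep.{u} N R => ρ.carrier) ∞) where

/-- The matrix whose entries are the families of all `ρ.mat i j`, in the `ℓ^∞`-product of the
C*-algebras of all `ρ`. -/
def univMat (N : ℕ) (R : ∀ k l : ℕ, Set (PLin k l)) :
    Matrix (Fin N) (Fin N) (lp (fun ρ : OrthRep.{u} N R => ρ.carrier) ∞) :=
  Matrix.of fun i j => ⟨fun ρ => ρ.mat i j,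
    memℓp_infty ⟨1, by rintro _ ⟨ρ, rfl⟩; exact ρ.norm_le i j⟩⟩

/-- The universal C*-algebra generated by `u_{ij}` with `u = ū`, `u u^t = u^t u = 1` and
`T_p u^{⊗k} = u^{⊗l} T_p` for all `p` in the collection `R`: the C*-algebra generated by the
families of all `ρ.mat i j` in the product of all representations `ρ` of these relations. -/
abbrev UnivAlg (N : ℕ) (R : ∀ k l : ℕ, Set (PLin k l)) : Type (u + 1) :=
  gen (univMat.{u} N R)

/-- The matrix of generators of the universal C*-algebra. -/
def univRep (N : ℕ) (R : ∀ k l : ℕ, Set (PLin k l)) :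
    Matrix (Fin N) (Fin N) (UnivAlg.{u} N R) :=
  restr (univMat.{u} N R)

/-- The free orthogonal quantum group `O_N^+`. -/
def freeOrth (N : ℕ) : Matrix (Fin N) (Fin N) (UnivAlg.{u} N fun _ _ => ∅) :=
  univRep N fun _ _ => ∅

/-- The collection that consists of the double singleton only. -/
inductive DoubleSingletonOnly : ∀ k l : ℕ, PLin k l → Prop
  | mk : DoubleSingletonOnly 0 2 doubleSingleton

/-- The quantum group `B_N^{#+}`, whose category is generated by the double singleton. -/
def bistochSharp (N : ℕ) :
    Matrix (Fin N) (Fin N) (UnivAlg.{u} N fun k l => {p | DoubleSingletonOnly k l p}) :=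
  univRep N fun k l => {p | DoubleSingletonOnly k l p}

/-! ### The quantum groups generated by the subrepresentation; here `N = n + 1` -/

/-- `d = ±1/√N`, for `N = n + 1`. -/
def dCoeff (ε : ℤˣ) (n : ℕ) : ℂ := ((ε : ℤ) : ℂ) / (Real.sqrt (n + 1) : ℂ)

/-- `c = -(1/(N-1)) (1 ± 1/√N)`, for `N = n + 1`. -/
def cCoeff (ε : ℤˣ) (n : ℕ) : ℂ := -(1 / (n : ℂ)) * (1 + dCoeff ε n)

/-- The orthogonal matrix `U_{(N,±)}`, for `N = n + 1`. -/
def Umat (ε : ℤˣ) (n : ℕ) : Matrix (Fin (n + 1)) (Fin (n + 1)) ℂ :=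
  Matrix.of fun i j =>
    if i = Fin.last n ∨ j = Fin.last n then dCoeff ε n
    else (if i = j then 1 else 0) + cCoeff ε n

/-- `V_{(N,±)}`: the first `N - 1` rows of `U_{(N,±)}`, for `N = n + 1`. -/
def Vmat (ε : ℤˣ) (n : ℕ) : Matrix (Fin n) (Fin (n + 1)) ℂ :=
  Matrix.of fun i j => Umat ε n i.castSucc j

/-- The matrix `v = V u V^*` over `C(G)`. -/
def subRep (ε : ℤˣ) {A : Type u} [CStarAlgebra A] {n : ℕ}
    (u : Matrix (Fin (n + 1)) (Fin (n + 1)) A) : Matrix (Fin n) (Fin n) A :=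
  scal A (Vmat ε n) * u * scal A (Vmat ε n)ᴴ

/-- `G^irr_± = V G V^*`: the matrix `v = V u V^*` over the C*-subalgebra of `C(G)` generated by
its entries. -/
def irr (ε : ℤˣ) {A : Type u} [CStarAlgebra A] {n : ℕ}
    (u : Matrix (Fin (n + 1)) (Fin (n + 1)) A) : Matrix (Fin n) (Fin n) (gen (subRep ε u)) :=
  restr (subRep ε u)

/-! ### The map `𝒱_{(N,±)}` on linear combinations of partitions; here `N = n + 1` -/

/-- The partition made from `p` by disconnecting all points of `I`. -/
@[reducible]
def Part.disconnect {k l : ℕ} (p : Part k l) (I : Finset (Fin k ⊕ Fin l)) : Part k l where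
  r x y := x = y ∨ (x ∉ I ∧ y ∉ I ∧ p x y)
  iseqv :=
    { refl := fun _ => Or.inl rfl
      symm := by
        rintro x y (rfl | ⟨hx, hy, h⟩)
        · exact Or.inl rfl
        · exact Or.inr ⟨hy, hx, p.symm h⟩
      trans := by
        rintro x y z (rfl | ⟨hx, hy, h⟩) (rfl | ⟨hy', hz, h'⟩)
        · exact Or.inl rfl
        · exact Or.inr ⟨hy', hz, h'⟩
        · exact Or.inr ⟨hx, hy, h⟩
        · exact Or.inr ⟨hx, hz, p.trans h h'⟩ }

open Classical in
/-- The points of a block of `p`. -/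
def Part.block {k l : ℕ} (p : Part k l) (B : Quotient p) : Finset (Fin k ⊕ Fin l) :=
  Finset.univ.filter fun x => Quotient.mk p x = B

open Classical in
/-- The coefficient, in `𝒱 b` for a block `b` with set of points `B`, of the term in which the
points of `I ∩ B` are disconnected. It is `c^i` if `i = |I ∩ B| < |B|`. If `I ⊇ B`, the term is
`c^{|B|} b_{|B|,|B|} + d^{|B|} ↑^{⊗|B|}` with `b_{|B|,|B|} = (N - 1) ↑^{⊗|B|}`. -/
def blockCoeff (ε : ℤˣ) (n : ℕ) {α : Type} (B I : Finset α) : ℂ :=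
  if B ⊆ I then (n : ℂ) * cCoeff ε n ^ B.card + dCoeff ε n ^ B.card
  else cCoeff ε n ^ (I ∩ B).card

open Classical in
/-- `𝒱_{(N,±)} p` for a partition `p`: the expansion of the product over all blocks `B` of `p` of
the sums over all subsets `I ∩ B` of points of `B` to be disconnected. -/
def calVPart (ε : ℤˣ) (n : ℕ) {k l : ℕ} (p : Part k l) : PLin k l :=
  ∑ I : Finset (Fin k ⊕ Fin l),
    Finsupp.single (p.disconnect I) (∏ B : Quotient p, blockCoeff ε n (p.block B) I)

/-- The linear map `𝒱_{(N,±)}`, for `N = n + 1`. -/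
def calV (ε : ℤˣ) (n : ℕ) {k l : ℕ} : PLin k l →ₗ[ℂ] PLin k l :=
  Finsupp.linearCombination ℂ (calVPart ε n)

/-- The collection `𝒱_{(N,±)} K = {𝒱_{(N,±)} p | p ∈ K}`, for `N = n + 1`. -/
def calVCat (ε : ℤˣ) (n : ℕ) (K : ∀ k l : ℕ, Submodule ℂ (PLin k l)) :
    ∀ k l : ℕ, Submodule ℂ (PLin k l) :=
  fun k l => (K k l).map (calV ε n)

end PartQG

end

noncomputable section

namespace PartQG

/-! Two mechanisms carry the proof. The first is linear algebra. The rows of `V` are orthonormal and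
orthogonal to the constant vector, so `V V^* = 1` and `V^* V = 1 - J/N`, with `J` the all-ones
matrix. The relations of `B_N^{#+}` force all row and column sums of `u` to be one and the same
element, so `u` commutes with `J` and hence with `V^* V`. Compression by `V` is therefore
multiplicative on `u`. This gives orthogonality of `v`, the comultiplication (`isCMQG_irr`), and the
description of `Mor(v^{⊗k}, v^{⊗l})` as the compression of `Mor(u^{⊗k}, u^{⊗l})`
(`mor_compression`). Part 2 (`T_calV`) expands each entry of the compressed `T_p` block by block, so
`G^irr` corresponds to the image of `𝒱`.

The second mechanism shows that this image is a category already at the level of partitions, where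
`T` cannot decide identities because it is not injective for small `N`. Everything is written in the
single parameter `d`: `N - 1 = 1/d^2 - 1` and `c = -d^2/(1 - d)`. Each identity for `𝒱` then
compares rational functions of `d` with poles only at `0` and `1`. It holds under `T` for every `d =
1/√N`, and `T` is injective once `N - 1 ≥ k + l` (`T_injective`). Infinitely many zeros make it hold
for all `d` other than `0` and `1`, so for small `N` and for both signs (`RatFam.eq_of_T`).

Composition is the one operation that `𝒱` does not preserve: `(𝒱 q)(𝒱 p) = 𝒱(q P^{⊗l} p)`, where `P`
is the combination of partitions behind `V^* V` (`parV_comp`). The hypothesis on `↑ ⊗ ↑` puts `P`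
into the category (`IsLinCat.singletons_mem`). -/

/-! ### Labellings of diagrams and the compatibility of `T` with the category operations -/

/-- The kernel condition: `f` is constant on the classes of `r`. -/
def Compat {α β : Type*} (r : Setoid α) (f : α → β) : Prop := ∀ x y, r x y → f x = f y

open Classical in
theorem partMatrix_apply (N : ℕ) {k l : ℕ} (p : Part k l) (j : Fin l → Fin N)
    (i : Fin k → Fin N) :
    partMatrix N p j i = if Compat p (Sum.elim i j) then 1 else 0 := by
  simp only [partMatrix, Compat, Matrix.of_apply]
  congr

theorem compat_glue {k l m : ℕ} {β : Type*} (q : Part l m) (p : Part k l)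
    (i : Fin k → β) (s : Fin l → β) (j : Fin m → β) :
    Compat (Part.glue q p) (Sum.elim i (Sum.elim s j)) ↔
      Compat q (Sum.elim s j) ∧ Compat p (Sum.elim i s) := by
  constructor
  · intro h
    refine ⟨fun x y hxy => h (.inr x) (.inr y) (.rel _ _ (.inr ⟨x, y, hxy, rfl, rfl⟩)),
      fun x y hxy => ?_⟩
    have := h _ _ (.rel _ _ (.inl ⟨x, y, hxy, rfl, rfl⟩))
    rcases x with x | x <;> rcases y with y | y <;> simpa using this
  · rintro ⟨hq, hp⟩ x y hxy
    change Relation.EqvGen _ x y at hxy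
    induction hxy with
    | rel x y h =>
      rcases h with ⟨a, b, hab, rfl, rfl⟩ | ⟨a, b, hab, rfl, rfl⟩
      · have := hp a b hab
        rcases a with a | a <;> rcases b with b | b <;> simpa using this
      · exact hq a b hab
    | refl x => rfl
    | symm x y _ ih => exact ih.symm
    | trans x y z _ _ ih₁ ih₂ => exact ih₁.trans ih₂

/-- The extension of a labelling of the outer points of a diagram to all its components. -/
def glueLabel {k l m : ℕ} {β : Type} (q : Part l m) (p : Part k l) (f : Fin k ⊕ Fin m → β)
    (g : {c : Quotient (Part.glue q p) //
      ∀ x : Fin k ⊕ Fin m, Quotient.mk (Part.glue q p) (Sum.map id Sum.inr x) ≠ c} → β)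
    (c : Quotient (Part.glue q p)) : β := by
  classical
  exact if h : ∃ x : Fin k ⊕ Fin m, Quotient.mk (Part.glue q p) (Sum.map id Sum.inr x) = c
    then f h.choose else g ⟨c, fun x hx => h ⟨x, hx⟩⟩

theorem glueLabel_outer {k l m : ℕ} {β : Type} (q : Part l m) (p : Part k l)
    (f : Fin k ⊕ Fin m → β) (hf : Compat (Part.comp q p) f) (g) (x : Fin k ⊕ Fin m) :
    glueLabel q p f g (Quotient.mk _ (Sum.map id Sum.inr x)) = f x := by
  have h : ∃ y : Fin k ⊕ Fin m, Quotient.mk (Part.glue q p) (Sum.map id Sum.inr y) =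
    Quotient.mk (Part.glue q p) (Sum.map id Sum.inr x) := ⟨x, rfl⟩
  rw [glueLabel, dif_pos h]
  exact hf _ _ (Quotient.exact (s := Part.glue q p) h.choose_spec)

theorem glueLabel_inner {k l m : ℕ} {β : Type} (q : Part l m) (p : Part k l)
    (f : Fin k ⊕ Fin m → β) (g) (c) :
    glueLabel q p f g c.1 = g c := by
  rw [glueLabel, dif_neg]
  rintro ⟨x, hx⟩
  exact c.2 x hx

theorem glueLabel_compat {k l m : ℕ} {β : Type} (q : Part l m) (p : Part k l)
    (i : Fin k → β) (j : Fin m → β) (hf : Compat (Part.comp q p) (Sum.elim i j)) (g) :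
    (fun x => glueLabel q p (Sum.elim i j) g (Quotient.mk _ x)) =
      Sum.elim i (Sum.elim
        (fun b => glueLabel q p (Sum.elim i j) g (Quotient.mk _ (.inr (.inl b)))) j) := by
  funext x
  rcases x with x | x | x
  · exact glueLabel_outer q p _ hf g (.inl x)
  · rfl
  · exact glueLabel_outer q p _ hf g (.inr x)

/-- Labellings of the middle points that are compatible with a given compatible labelling of the
outer points correspond to labellings of the closed components. -/
def middleEquiv {k l m : ℕ} {β : Type} (q : Part l m) (p : Part k l)
    (i : Fin k → β) (j : Fin m → β) (hf : Compat (Part.comp q p) (Sum.elim i j)) :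
    {s : Fin l → β // Compat (Part.glue q p) (Sum.elim i (Sum.elim s j))} ≃
      ({c : Quotient (Part.glue q p) //
      ∀ x : Fin k ⊕ Fin m, Quotient.mk (Part.glue q p) (Sum.map id Sum.inr x) ≠ c} → β) where
  toFun s c := Quotient.lift (Sum.elim i (Sum.elim s.1 j)) s.2 c.1
  invFun g := ⟨fun b => glueLabel q p (Sum.elim i j) g (Quotient.mk _ (.inr (.inl b))), by
    rw [← glueLabel_compat q p i j hf g]
    intro x y hxy
    exact congrArg _ (Quotient.sound hxy)⟩
  left_inv s := by
    ext b
    dsimp only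
    by_cases h : ∃ x : Fin k ⊕ Fin m, Quotient.mk (Part.glue q p) (Sum.map id Sum.inr x) =
      Quotient.mk (Part.glue q p) (.inr (.inl b))
    · obtain ⟨x, hx⟩ := h
      rw [← hx, glueLabel_outer q p _ hf]
      have := s.2 _ _ (Quotient.exact hx)
      rw [← show Sum.elim i (Sum.elim s.1 j) (.inr (.inl b)) = s.1 b from rfl, ← this]
      rcases x with x | x <;> rfl
    · exact glueLabel_inner q p _ _ ⟨_, fun x hx => h ⟨x, hx⟩⟩
  right_inv g := by
    funext c
    obtain ⟨c, hc⟩ := c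
    induction c using Quotient.inductionOn with
    | h x =>
      dsimp only [Quotient.lift_mk]
      refine (congrFun (glueLabel_compat q p i j hf g) x).symm.trans ?_
      exact glueLabel_inner q p _ g ⟨_, hc⟩

/-- An entry of the product counts the middle labellings compatible with both diagrams. If the outer
labels are compatible with the composite, the labels on components that reach an outer point are
forced and each closed component is free, which gives `N^loops`. Otherwise there are none. -/
theorem partMatrix_comp (N : ℕ) {k l m : ℕ} (q : Part l m) (p : Part k l) :
    partMatrix N q * partMatrix N p =
      ((N : ℂ) ^ Part.loops q p) • partMatrix N (Part.comp q p) := by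
  classical
  ext j i
  simp only [Matrix.mul_apply, Matrix.smul_apply, partMatrix_apply, smul_eq_mul]
  have h : ∀ s : Fin l → Fin N,
      ((if Compat q (Sum.elim s j) then (1 : ℂ) else 0) *
        if Compat p (Sum.elim i s) then 1 else 0) =
      if Compat (Part.glue q p) (Sum.elim i (Sum.elim s j)) then 1 else 0 := by
    intro s
    rw [compat_glue]
    split_ifs <;> simp_all
  simp only [h]
  rw [Finset.sum_boole]
  by_cases hf : Compat (Part.comp q p) (Sum.elim i j)
  · rw [if_pos hf, mul_one, ← Fintype.card_subtype,
      ← Nat.card_eq_fintype_card, Nat.card_congr (middleEquiv q p i j hf), Nat.card_fun]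
    simp [Part.loops]
  · rw [if_neg hf, mul_zero, Nat.cast_eq_zero, Finset.card_eq_zero, Finset.filter_eq_empty_iff]
    intro s _ hs
    refine hf fun x y hxy => ?_
    have := hs _ _ hxy
    rcases x with x | x <;> rcases y with y | y <;> simpa using this

theorem T_single (N : ℕ) {k l : ℕ} (p : Part k l) (x : ℂ) :
    T N (Finsupp.single p x) = x • partMatrix N p := by
  simp [T]

theorem T_eq_sum (N : ℕ) {k l : ℕ} (p : PLin k l) :
    T N p = p.sum fun a x => x • partMatrix N a :=
  Finsupp.linearCombination_apply _ _

theorem T_compLin (N : ℕ) {k l m : ℕ} (q : PLin l m) (p : PLin k l) :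
    T N (compLin N q p) = T N q * T N p := by
  rw [T_eq_sum N q, T_eq_sum N p, compLin, map_finsuppSum]
  simp only [map_finsuppSum, T_single, mul_smul, ← partMatrix_comp]
  simp only [Finsupp.sum, Matrix.sum_mul]
  simp only [Matrix.mul_sum, Matrix.smul_mul, Matrix.mul_smul]
  exact Finset.sum_congr rfl fun _ _ => Finset.sum_congr rfl fun _ _ => smul_comm _ _ _

theorem compat_comap {α β γ : Type*} (r : Setoid β) (e : α ≃ β) (f : α → γ) :
    Compat (r.comap e) f ↔ Compat r (f ∘ e.symm) := by
  constructor
  · intro h x y hxy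
    exact h _ _ (by simpa [Setoid.comap_rel] using hxy)
  · intro h x y hxy
    simpa using h (e x) (e y) hxy

theorem compat_sumSetoid {α β : Type} {γ : Type*} (p : Setoid α) (q : Setoid β) (f : α ⊕ β → γ) :
    Compat (sumSetoid p q) f ↔ Compat p (f ∘ Sum.inl) ∧ Compat q (f ∘ Sum.inr) := by
  constructor
  · intro h
    exact ⟨fun x y hxy => h _ _ (.inl hxy), fun x y hxy => h _ _ (.inr hxy)⟩
  · rintro ⟨hp, hq⟩ _ _ (h | h)
    · exact hp _ _ h
    · exact hq _ _ h

theorem compat_tensor {β : Type*} {k l k' l' : ℕ} (p : Part k l) (q : Part k' l')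
    (i : Fin (k + k') → β) (j : Fin (l + l') → β) :
    Compat (Part.tensor p q) (Sum.elim i j) ↔
      Compat p (Sum.elim (i ∘ Fin.castAdd k') (j ∘ Fin.castAdd l')) ∧
        Compat q (Sum.elim (i ∘ Fin.natAdd k) (j ∘ Fin.natAdd l)) := by
  refine (compat_comap (sumSetoid p q) ((Equiv.sumCongr finSumFinEquiv.symm
    finSumFinEquiv.symm).trans (Equiv.sumSumSumComm (Fin k) (Fin k') (Fin l) (Fin l'))) _).trans ?_
  rw [compat_sumSetoid]
  have e1 : (Sum.elim i j ∘ ((Equiv.sumCongr finSumFinEquiv.symm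
    finSumFinEquiv.symm).trans (Equiv.sumSumSumComm (Fin k) (Fin k') (Fin l) (Fin l'))).symm) ∘
      Sum.inl = Sum.elim (i ∘ Fin.castAdd k') (j ∘ Fin.castAdd l') := by
    funext x; rcases x with x | x <;> simp
  have e2 : (Sum.elim i j ∘ ((Equiv.sumCongr finSumFinEquiv.symm
    finSumFinEquiv.symm).trans (Equiv.sumSumSumComm (Fin k) (Fin k') (Fin l) (Fin l'))).symm) ∘
      Sum.inr = Sum.elim (i ∘ Fin.natAdd k) (j ∘ Fin.natAdd l) := by
    funext x; rcases x with x | x <;> simp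
  rw [e1, e2]

theorem partMatrix_tensor (N : ℕ) {k l k' l' : ℕ} (p : Part k l) (q : Part k' l')
    (j : Fin (l + l') → Fin N) (i : Fin (k + k') → Fin N) :
    partMatrix N (Part.tensor p q) j i =
      partMatrix N p (j ∘ Fin.castAdd l') (i ∘ Fin.castAdd k') *
        partMatrix N q (j ∘ Fin.natAdd l) (i ∘ Fin.natAdd k) := by
  classical
  simp only [partMatrix_apply, compat_tensor]
  split_ifs <;> simp_all

theorem T_tensorLin (N : ℕ) {k l k' l' : ℕ} (p : PLin k l) (q : PLin k' l')
    (j : Fin (l + l') → Fin N) (i : Fin (k + k') → Fin N) :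
    T N (tensorLin p q) j i =
      T N p (j ∘ Fin.castAdd l') (i ∘ Fin.castAdd k') *
        T N q (j ∘ Fin.natAdd l) (i ∘ Fin.natAdd k) := by
  rw [T_eq_sum N q, T_eq_sum N p, tensorLin, map_finsuppSum]
  simp only [map_finsuppSum, T_single]
  simp only [Finsupp.sum, Matrix.sum_apply, Matrix.smul_apply, partMatrix_tensor,
    Finset.sum_mul_sum, smul_eq_mul]
  exact Finset.sum_congr rfl fun _ _ => Finset.sum_congr rfl fun _ _ => by ring

theorem partMatrix_invol (N : ℕ) {k l : ℕ} (p : Part k l) :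
    partMatrix N (Part.invol p) = (partMatrix N p)ᵀ := by
  classical
  ext j i
  simp only [partMatrix_apply, Matrix.transpose_apply]
  have h : Compat (Part.invol p) (Sum.elim i j) ↔ Compat p (Sum.elim j i) := by
    refine (compat_comap p (Equiv.sumComm _ _) _).trans ?_
    have e : Sum.elim i j ∘ (Equiv.sumComm (Fin l) (Fin k)).symm = Sum.elim j i := by
      funext x; rcases x with x | x <;> simp
    rw [e]
  simp only [h]

/-! ### Injectivity of `T` when there are enough labels -/

theorem exists_ker_eq {α : Type*} [Fintype α] {N : ℕ} (hN : Fintype.card α ≤ N) (r : Setoid α) :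
    ∃ f : α → Fin N, ∀ x y, f x = f y ↔ r x y := by
  classical
  have e : Fintype.card (Quotient r) ≤ Fintype.card (Fin N) := by
    rw [Fintype.card_fin]
    exact (Fintype.card_quotient_le r).trans hN
  obtain ⟨g⟩ := Function.Embedding.nonempty_of_card_le e
  exact ⟨fun x => g (Quotient.mk r x), fun x y => by rw [g.injective.eq_iff]; exact Quotient.eq⟩

instance {α : Type*} [Finite α] : Finite (Setoid α) :=
  Finite.of_injective (fun r : Setoid α => r.r) fun r s h => by
    ext x y
    exact iff_of_eq (congrFun (congrFun h x) y)

instance (k l : ℕ) : Fintype (Part k l) := Fintype.ofFinite _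

/-- With `k + l` labels available, some labelling has kernel exactly `r`, and the entry of `T p`
there is the sum of the coefficients of all partitions finer than or equal to `r`. Induction along
refinement then removes the coefficients one at a time. -/
theorem T_injective {N k l : ℕ} (hN : k + l ≤ N) : Function.Injective (T N (k := k) (l := l)) := by
  classical
  rw [injective_iff_map_eq_zero]
  intro p hp
  have key : ∀ r : Part k l, ∑ a, (if a ≤ r then p a else 0) = 0 := by
    intro r
    obtain ⟨f, hf⟩ := exists_ker_eq (N := N) (by simpa using hN) r
    have h := congrFun (congrFun hp (f ∘ Sum.inr)) (f ∘ Sum.inl)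
    rw [T_eq_sum, Finsupp.sum_fintype _ _ (by simp)] at h
    simp only [Matrix.sum_apply, Matrix.smul_apply, partMatrix_apply, Sum.elim_comp_inl_inr,
      smul_eq_mul, mul_ite, mul_one, mul_zero, Matrix.zero_apply] at h
    refine Eq.trans ?_ h
    refine Finset.sum_congr rfl fun a _ => ?_
    have : a ≤ r ↔ Compat a f := by
      simp only [Compat, hf]
      exact Iff.rfl
    simp only [this]
  ext r
  induction r using WellFoundedLT.induction with
  | ind r ih =>
    have h := key r
    rw [Finset.sum_eq_single r] at h
    · simpa using h
    · intro a _ ha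
      split_ifs with har
      · exact ih a (lt_of_le_of_ne har ha)
      · rfl
    · simp

/-! ### The block expansion of `𝒱` -/

open Classical in
/-- The coefficient `blockCoeff`, with independent parameters. -/
def blockWeight (x c d : ℂ) {α : Type} (B I : Finset α) : ℂ :=
  if B ⊆ I then x * c ^ B.card + d ^ B.card else c ^ (I ∩ B).card

open Classical in
/-- The linear combination `calVPart`, with independent parameters. -/
def expand (x c d : ℂ) {k l : ℕ} (p : Part k l) : PLin k l :=
  ∑ I : Finset (Fin k ⊕ Fin l),
    Finsupp.single (p.disconnect I) (∏ B : Quotient p, blockWeight x c d (p.block B) I)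

/-- The linear map `calV`, with independent parameters. -/
def expandLin (x c d : ℂ) {k l : ℕ} : PLin k l →ₗ[ℂ] PLin k l :=
  Finsupp.linearCombination ℂ (expand x c d)

theorem expandLin_eq_calV (ε : ℤˣ) (n k l : ℕ) :
    expandLin n (cCoeff ε n) (dCoeff ε n) (k := k) (l := l) = calV ε n := rfl

theorem tpow_apply {A : Type*} [CommSemiring A] {ι κ : Type*} (u : Matrix ι κ A) (k : ℕ)
    (i : Fin k → ι) (j : Fin k → κ) : tpow u k i j = ∏ a, u (i a) (j a) := by
  simp [tpow, List.prod_ofFn]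

open Classical in
theorem sum_compat {α β M : Type*} [Fintype α] [Fintype β] [AddCommMonoid M] [DecidableEq α]
    (r : Setoid α) [Fintype (Quotient r)] [DecidableEq (Quotient r)] (F : (α → β) → M) :
    ∑ g : α → β, (if Compat r g then F g else 0) =
      ∑ h : Quotient r → β, F fun x => h (Quotient.mk r x) := by
  rw [← Finset.sum_filter]
  symm
  refine Finset.sum_bij (fun h _ x => h (Quotient.mk r x)) ?_ ?_ ?_ ?_
  · intro h _
    simp only [Finset.mem_filter, Finset.mem_univ, true_and]
    exact fun x y hxy => congrArg h (Quotient.sound hxy)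
  · intro h _ h' _ hh
    funext c
    induction c using Quotient.inductionOn with
    | h x => exact congrFun hh x
  · intro g hg
    simp only [Finset.mem_filter, Finset.mem_univ, true_and] at hg
    exact ⟨Quotient.lift g hg, Finset.mem_univ _, rfl⟩
  · intro h _
    rfl

theorem mem_block {k l : ℕ} (p : Part k l) (B : Quotient p) (x : Fin k ⊕ Fin l) :
    x ∈ p.block B ↔ Quotient.mk p x = B := by
  simp [Part.block]

open Classical in
theorem prod_eq_prod_block {k l : ℕ} (p : Part k l) {M : Type*} [CommMonoid M]
    (F : Fin k ⊕ Fin l → M) :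
    ∏ x, F x = ∏ B : Quotient p, ∏ x ∈ p.block B, F x := by
  rw [← Finset.prod_fiberwise (g := Quotient.mk p)]
  refine Finset.prod_congr rfl fun B _ => Finset.prod_congr ?_ fun _ _ => rfl
  ext x
  simp [mem_block]

open Classical in
/-- The contribution of a single block: a sum over the labels of the block. -/
theorem sum_prod_block {α : Type} {n : ℕ} (c d : ℂ) (V : Matrix (Fin n) (Fin (n + 1)) ℂ)
    (hV : ∀ i j, V i (Fin.castSucc j) = (if i = j then 1 else 0) + c)
    (hV' : ∀ i, V i (Fin.last n) = d) (B : Finset α) (f : α → Fin n) (hB : B.Nonempty) :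
    ∑ m, ∏ x ∈ B, V (f x) m =
      ∑ J ∈ B.powerset, blockWeight n c d B J *
        if (∀ x ∈ B, x ∉ J → ∀ y ∈ B, y ∉ J → f x = f y) then 1 else 0 := by
  rw [Fin.sum_univ_castSucc]
  simp only [hV, hV', Finset.prod_const]
  -- In the expanded product, `J` is the set of points whose factor contributes `c`; these are the
  -- points to be disconnected.
  simp only [add_comm _ c, Finset.prod_add, Finset.prod_const]
  rw [Finset.sum_comm]
  -- If a point of `B` lies outside `J`, the Kronecker deltas force `m` to be the common label of
  -- all such points, so at most one `m` survives. If `J = B`, nothing constrains `m` and all `n`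
  -- values count.
  have hcount : ∀ J ∈ B.powerset, ∑ m : Fin n, c ^ J.card * ∏ x ∈ B \ J,
      (if f x = m then (1 : ℂ) else 0) = if J = B then n * c ^ B.card else
        blockWeight n c d B J *
          if (∀ x ∈ B, x ∉ J → ∀ y ∈ B, y ∉ J → f x = f y) then 1 else 0 := by
    intro J hJ
    rw [Finset.mem_powerset] at hJ
    split_ifs with h1 h2
    · subst h1; simp
    · rw [blockWeight, if_neg fun h => h1 (hJ.antisymm h), Finset.inter_eq_left.2 hJ,
        ← Finset.mul_sum]
      congr 1
      obtain ⟨x, hx⟩ : (B \ J).Nonempty := Finset.sdiff_nonempty.2 fun h => h1 (hJ.antisymm h)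
      simp only [Finset.prod_boole]
      rw [Finset.sum_eq_single (f x)]
      · rw [Finset.mem_sdiff] at hx
        rw [if_pos]
        intro y hy
        rw [Finset.mem_sdiff] at hy
        exact h2 y hy.1 hy.2 x hx.1 hx.2
      · intro m _ hm
        rw [if_neg]
        exact fun h => hm (h x hx).symm
      · simp
    · rw [mul_zero]
      refine Finset.sum_eq_zero fun m _ => ?_
      rw [Finset.prod_boole, if_neg, mul_zero]
      intro h
      refine h2 fun x hx hx' y hy hy' => ?_
      rw [h x (Finset.mem_sdiff.2 ⟨hx, hx'⟩), h y (Finset.mem_sdiff.2 ⟨hy, hy'⟩)]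
  rw [Finset.sum_congr rfl hcount, ← Finset.add_sum_erase _ _ (Finset.mem_powerset_self B),
    ← Finset.add_sum_erase (a := B) _ _ (Finset.mem_powerset_self B)]
  -- The last column of `V` contributes `d^|B|`; it joins the term `J = B`.
  rw [if_pos rfl, if_pos (fun x hx hx' => absurd hx hx'), mul_one, blockWeight,
    if_pos (Finset.Subset.refl B), add_right_comm]
  congr 1
  refine Finset.sum_congr rfl fun J hJ => ?_
  rw [if_neg (Finset.ne_of_mem_erase hJ)]

theorem compat_disconnect {k l : ℕ} {β : Type*} (p : Part k l) (I : Finset (Fin k ⊕ Fin l))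
    (f : Fin k ⊕ Fin l → β) :
    Compat (p.disconnect I) f ↔
      ∀ B : Quotient p, ∀ x ∈ p.block B, x ∉ I → ∀ y ∈ p.block B, y ∉ I → f x = f y := by
  simp only [mem_block]
  constructor
  · rintro h B x rfl hx y hxy hy
    exact h x y (.inr ⟨hx, hy, Quotient.exact hxy.symm⟩)
  · rintro h x y (rfl | ⟨hx, hy, hxy⟩)
    · rfl
    · exact h _ x rfl hx y (Quotient.sound (p.symm hxy)) hy

theorem blockWeight_inter (x c d : ℂ) {α : Type} [DecidableEq α] (B I : Finset α) :
    blockWeight x c d B (I ∩ B) = blockWeight x c d B I := by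
  have e : B ⊆ I ∩ B ↔ B ⊆ I := by simp [Finset.subset_inter_iff]
  simp only [blockWeight, e]
  congr 3
  ext x
  simp

open Classical in
/-- Families of subsets of the blocks of `p` correspond to sets of points. -/
theorem prod_sum_block {k l : ℕ} (p : Part k l) (F : Quotient p → Finset (Fin k ⊕ Fin l) → ℂ) :
    ∏ B, ∑ J ∈ (p.block B).powerset, F B J =
      ∑ I : Finset (Fin k ⊕ Fin l), ∏ B, F B (I ∩ p.block B) := by
  rw [Finset.prod_univ_sum]
  symm
  refine Finset.sum_bij' (fun I _ B => I ∩ p.block B)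
    (fun J _ => Finset.univ.filter fun x => x ∈ J (Quotient.mk p x)) ?_ ?_ ?_ ?_ ?_
  · intro I _
    simp [Fintype.mem_piFinset]
  · intro J _
    exact Finset.mem_univ _
  · intro I _
    ext x
    simp [mem_block]
  · intro J hJ
    simp only [Fintype.mem_piFinset, Finset.mem_powerset] at hJ
    funext B
    ext x
    simp only [Finset.mem_inter, Finset.mem_filter, Finset.mem_univ, true_and, mem_block]
    constructor
    · rintro ⟨h, rfl⟩
      exact h
    · intro h
      have := (mem_block p B x).1 (hJ B h)
      subst this
      exact ⟨h, rfl⟩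
  · intro I _
    rfl

-- An entry of the right-hand side is a sum over labellings that are constant on the blocks of `p`,
-- that is, over one label per block. It factors into a product of block sums, each expanded by
-- `sum_prod_block`. A choice of a subset of each block is the same as one set `I` of points.
open Classical in
theorem T_expand {n : ℕ} (c d : ℂ) (V : Matrix (Fin n) (Fin (n + 1)) ℂ)
    (hV : ∀ i j, V i (Fin.castSucc j) = (if i = j then 1 else 0) + c)
    (hV' : ∀ i, V i (Fin.last n) = d) {k l : ℕ} (p : Part k l) :
    T n (expand n c d p) = tpow V l * partMatrix (n + 1) p * tpow Vᵀ k := by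
  ext j i
  have h1 : (tpow V l * partMatrix (n + 1) p * tpow Vᵀ k) j i =
      ∑ g : Fin k ⊕ Fin l → Fin (n + 1), if Compat p g then
        ∏ x, V (Sum.elim i j x) (g x) else 0 := by
    rw [← (Equiv.sumArrowEquivProdArrow (Fin k) (Fin l) (Fin (n + 1))).symm.sum_comp,
      Fintype.sum_prod_type, Matrix.mul_apply]
    refine Finset.sum_congr rfl fun i' _ => ?_
    rw [Matrix.mul_apply, Finset.sum_mul]
    refine Finset.sum_congr rfl fun j' _ => ?_
    rw [partMatrix_apply, tpow_apply, tpow_apply]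
    have : (Equiv.sumArrowEquivProdArrow (Fin k) (Fin l) (Fin (n + 1))).symm (i', j') =
      Sum.elim i' j' := rfl
    rw [this, Fintype.prod_sum_type]
    simp only [Sum.elim_inl, Sum.elim_inr, Matrix.transpose_apply]
    split_ifs <;> ring
  rw [h1, sum_compat]
  have h2 : ∀ h : Quotient p → Fin (n + 1), ∏ x, V (Sum.elim i j x) (h (Quotient.mk p x)) =
      ∏ B, ∏ x ∈ p.block B, V (Sum.elim i j x) (h B) := by
    intro h
    rw [prod_eq_prod_block p]
    refine Finset.prod_congr rfl fun B _ => Finset.prod_congr rfl fun x hx => ?_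
    rw [(mem_block p B x).1 hx]
  simp only [h2]
  have h4 := Finset.prod_univ_sum (fun _ : Quotient p => (Finset.univ : Finset (Fin (n + 1))))
    fun B m => ∏ x ∈ p.block B, V (Sum.elim i j x) m
  rw [Fintype.piFinset_univ] at h4
  rw [← h4]
  have h3 : ∀ B : Quotient p, (p.block B).Nonempty := by
    intro B
    induction B using Quotient.inductionOn with
    | h x => exact ⟨x, (mem_block p _ x).2 rfl⟩
  rw [Finset.prod_congr rfl fun B _ => sum_prod_block c d V hV hV' (p.block B) _ (h3 B),
    prod_sum_block]
  simp only [expand, map_sum, T_single, Matrix.sum_apply, Matrix.smul_apply, partMatrix_apply,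
    smul_eq_mul]
  refine Finset.sum_congr rfl fun I _ => ?_
  rw [Finset.prod_mul_distrib]
  simp only [blockWeight_inter]
  congr 1
  by_cases h : Compat (p.disconnect I) (Sum.elim i j)
  · rw [if_pos h]
    symm
    refine Finset.prod_eq_one fun B _ => if_pos ?_
    rw [compat_disconnect] at h
    intro x hx hx' y hy hy'
    exact h B x hx (fun h => hx' (Finset.mem_inter.2 ⟨h, hx⟩)) y hy
      fun h => hy' (Finset.mem_inter.2 ⟨h, hy⟩)
  · rw [if_neg h]
    rw [compat_disconnect, not_forall] at h
    obtain ⟨B, hB⟩ := h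
    symm
    refine Finset.prod_eq_zero (Finset.mem_univ B) (if_neg fun h => hB fun x hx hx' y hy hy' => ?_)
    exact h x hx (fun h => hx' (Finset.mem_inter.1 h).1) y hy
      fun h => hy' (Finset.mem_inter.1 h).1

theorem T_expandLin {n : ℕ} (c d : ℂ) (V : Matrix (Fin n) (Fin (n + 1)) ℂ)
    (hV : ∀ i j, V i (Fin.castSucc j) = (if i = j then 1 else 0) + c)
    (hV' : ∀ i, V i (Fin.last n) = d) {k l : ℕ} (p : PLin k l) :
    T n (expandLin n c d p) = tpow V l * T (n + 1) p * tpow Vᵀ k := by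
  induction p using Finsupp.induction_linear with
  | zero => simp
  | add p q hp hq => simp only [map_add, hp, hq, Matrix.mul_add, Matrix.add_mul]
  | single a x =>
    rw [expandLin, Finsupp.linearCombination_single, map_smul, T_expand c d V hV hV', T_single,
      Matrix.mul_smul, Matrix.smul_mul]

/-! ### The coisometry `V` -/

theorem Vmat_castSucc (ε : ℤˣ) (n : ℕ) (i j : Fin n) :
    Vmat ε n i j.castSucc = (if i = j then 1 else 0) + cCoeff ε n := by
  simp [Vmat, Umat, Fin.castSucc_ne_last]

theorem Vmat_last (ε : ℤˣ) (n : ℕ) (i : Fin n) : Vmat ε n i (Fin.last n) = dCoeff ε n := by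
  simp [Vmat, Umat]

theorem star_dCoeff (ε : ℤˣ) (n : ℕ) : star (dCoeff ε n) = dCoeff ε n := by
  simp [dCoeff]

theorem star_cCoeff (ε : ℤˣ) (n : ℕ) : star (cCoeff ε n) = cCoeff ε n := by
  have := star_dCoeff ε n
  simp only [Complex.star_def] at this
  simp [cCoeff, this]

theorem star_Vmat (ε : ℤˣ) (n : ℕ) (i : Fin n) (j : Fin (n + 1)) :
    star (Vmat ε n i j) = Vmat ε n i j := by
  induction j using Fin.lastCases with
  | last => rw [Vmat_last, star_dCoeff]
  | cast j => rw [Vmat_castSucc, star_add, star_cCoeff, apply_ite star, star_one, star_zero]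

theorem Vmat_conjTranspose (ε : ℤˣ) (n : ℕ) : (Vmat ε n)ᴴ = (Vmat ε n)ᵀ := by
  ext i j
  simp [Matrix.conjTranspose_apply, star_Vmat]

theorem T_calV (ε : ℤˣ) (n : ℕ) {k l : ℕ} (p : PLin k l) :
    T n (calV ε n p) = tpow (Vmat ε n) l * T (n + 1) p * tpow (Vmat ε n)ᴴ k := by
  rw [Vmat_conjTranspose, ← expandLin_eq_calV]
  exact T_expandLin _ _ _ (Vmat_castSucc ε n) (Vmat_last ε n) p

theorem dCoeff_sq (ε : ℤˣ) (n : ℕ) : dCoeff ε n ^ 2 = 1 / (n + 1 : ℂ) := by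
  have h : ((ε : ℤ) : ℂ) ^ 2 = 1 := by
    rcases Int.units_eq_one_or ε with rfl | rfl <;> simp
  rw [dCoeff, div_pow, h]
  congr 1
  rw [← Complex.ofReal_pow, Real.sq_sqrt (by positivity)]
  push_cast
  rfl

theorem natCast_add_one_ne_zero (n : ℕ) : (n + 1 : ℂ) ≠ 0 := by exact_mod_cast n.succ_ne_zero

/-- The left-hand side is the deviation of the Gram matrix of the rows of `V` from the identity.
Since `c (2 + n c) = -(1 - d^2)/n`, it vanishes exactly because `d^2 = 1/(n + 1)`. -/
theorem coeff_relation (ε : ℤˣ) {n : ℕ} (hn : 1 ≤ n) :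
    2 * cCoeff ε n + n * cCoeff ε n ^ 2 + dCoeff ε n ^ 2 = 0 := by
  have h0 : (n : ℂ) ≠ 0 := by exact_mod_cast (by omega : n ≠ 0)
  have h1 := natCast_add_one_ne_zero n
  have h := dCoeff_sq ε n
  have e : 2 * cCoeff ε n + n * cCoeff ε n ^ 2 + dCoeff ε n ^ 2 =
      (dCoeff ε n ^ 2 * (n + 1) - 1) / n := by
    rw [cCoeff]
    field_simp
    ring
  rw [e, h]
  field_simp
  simp

theorem coeff_row_sum (ε : ℤˣ) {n : ℕ} (hn : 1 ≤ n) :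
    1 + n * cCoeff ε n + dCoeff ε n = 0 := by
  have h0 : (n : ℂ) ≠ 0 := by exact_mod_cast (by omega : n ≠ 0)
  rw [cCoeff]
  field_simp
  ring

theorem Vmat_mul_conjTranspose (ε : ℤˣ) {n : ℕ} (hn : 1 ≤ n) :
    Vmat ε n * (Vmat ε n)ᴴ = 1 := by
  rw [Vmat_conjTranspose]
  ext i j
  have h := coeff_relation ε hn
  simp only [Matrix.mul_apply, Matrix.transpose_apply, Fin.sum_univ_castSucc, Vmat_castSucc,
    Vmat_last, add_mul, mul_add, Finset.sum_add_distrib, Matrix.one_apply]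
  simp
  linear_combination h

theorem Vmat_sum (ε : ℤˣ) {n : ℕ} (hn : 1 ≤ n) (i : Fin n) : ∑ j, Vmat ε n i j = 0 := by
  rw [Fin.sum_univ_castSucc]
  simp only [Vmat_castSucc, Vmat_last, Finset.sum_add_distrib]
  simpa using coeff_row_sum ε hn

/-- This is the projection onto the orthogonal complement of the constant vector: the `n` rows of
`V` form an orthonormal basis of it. The proof checks entries, according to which of the two indices
is the last one. -/
theorem conjTranspose_mul_Vmat (ε : ℤˣ) {n : ℕ} (hn : 1 ≤ n) :
    (Vmat ε n)ᴴ * Vmat ε n = 1 - (1 / (n + 1 : ℂ)) • Matrix.of fun _ _ => 1 := by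
  have h := coeff_relation ε hn
  have h1 := coeff_row_sum ε hn
  have h2 := dCoeff_sq ε n
  have h3 := natCast_add_one_ne_zero n
  have h4 : (n : ℂ) * dCoeff ε n ^ 2 = 1 - 1 / (n + 1 : ℂ) := by
    rw [h2]; field_simp; ring
  rw [one_div] at h2
  rw [Vmat_conjTranspose]
  ext i j
  induction i using Fin.lastCases <;> induction j using Fin.lastCases <;>
  simp [Matrix.mul_apply, Vmat_castSucc, Vmat_last, add_mul, mul_add, Finset.sum_add_distrib,
    Matrix.one_apply, Fin.castSucc_ne_last, (Fin.castSucc_ne_last _).symm]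
  · rw [one_div] at h4
    linear_combination h4
  · linear_combination dCoeff ε n * h1 - h2
  · linear_combination dCoeff ε n * h1 - h2
  · rename_i a b
    have e : (if b = a then (1 : ℂ) else 0) = if a = b then 1 else 0 := if_congr eq_comm rfl rfl
    rw [e]
    linear_combination h - h2

/-! ### Tensor powers of matrices -/

theorem tpow_succ {A : Type*} [Semiring A] {ι κ : Type*} (u : Matrix ι κ A) (k : ℕ)
    (i : Fin (k + 1) → ι) (j : Fin (k + 1) → κ) :
    tpow u (k + 1) i j = u (i 0) (j 0) * tpow u k (Fin.tail i) (Fin.tail j) := by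
  simp [tpow, List.ofFn_succ, Fin.tail]

theorem tpow_zero {A : Type*} [Semiring A] {ι κ : Type*} (u : Matrix ι κ A)
    (i : Fin 0 → ι) (j : Fin 0 → κ) : tpow u 0 i j = 1 := by
  simp [tpow]

theorem commute_tpow {A : Type*} [Semiring A] {ι κ : Type*} (u : Matrix ι κ A) (x : A)
    (h : ∀ i j, Commute x (u i j)) (k : ℕ) (i : Fin k → ι) (j : Fin k → κ) :
    Commute x (tpow u k i j) := by
  induction k with
  | zero => rw [tpow_zero]; exact Commute.one_right x
  | succ k ih => rw [tpow_succ]; exact (h _ _).mul_right (ih _ _)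

/-- Entries of a tensor power are ordered products, so regrouping `(u v)(u v)⋯` into `u⋯u v⋯v` moves
entries of `v` past later entries of `u`. In the applications one of the two matrices is scalar. -/
theorem tpow_mul {A : Type*} [Semiring A] {ι κ μ : Type*} [Fintype κ] (u : Matrix ι κ A)
    (v : Matrix κ μ A) (h : ∀ i j i' j', Commute (u i j) (v i' j')) (k : ℕ) :
    tpow (u * v) k = tpow u k * tpow v k := by
  induction k with
  | zero => ext i j; simp [Matrix.mul_apply, tpow_zero]
  | succ k ih =>
    ext i j
    rw [tpow_succ, ih, Matrix.mul_apply, Matrix.mul_apply, Matrix.mul_apply,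
      ← (Fin.consEquiv fun _ => κ).sum_comp, Fintype.sum_prod_type, Finset.sum_mul_sum]
    refine Finset.sum_congr rfl fun a _ => Finset.sum_congr rfl fun b _ => ?_
    rw [tpow_succ, tpow_succ]
    simp only [Fin.consEquiv_apply, Fin.cons_zero]
    have ht : Fin.tail ((Fin.consEquiv fun _ => κ) (a, b)) = b := rfl
    rw [ht]
    rw [mul_assoc, mul_assoc, ← mul_assoc (v _ _), ← mul_assoc (tpow u k _ _),
      (commute_tpow u _ (fun i j => (h i j _ _).symm) k _ _).eq]

theorem tpow_one {A : Type*} [CommSemiring A] {ι : Type*} [DecidableEq ι] (k : ℕ) :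
    tpow (1 : Matrix ι ι A) k = 1 := by
  ext i j
  simp only [tpow_apply, Matrix.one_apply, Finset.prod_boole, funext_iff, Finset.mem_univ,
    true_imp_iff]

theorem tpow_transpose {A : Type*} [CommSemiring A] {ι κ : Type*} (u : Matrix ι κ A) (k : ℕ) :
    tpow uᵀ k = (tpow u k)ᵀ := rfl

/-- `M` is the Kronecker product of `A` and `B`. -/
def IsKron {ι κ : Type*} {k l k' l' : ℕ} (M : Matrix (Fin (l + l') → ι) (Fin (k + k') → κ) ℂ)
    (A : Matrix (Fin l → ι) (Fin k → κ) ℂ) (B : Matrix (Fin l' → ι) (Fin k' → κ) ℂ) : Prop :=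
  ∀ j i, M j i = A (j ∘ Fin.castAdd l') (i ∘ Fin.castAdd k') *
    B (j ∘ Fin.natAdd l) (i ∘ Fin.natAdd k)

theorem IsKron.mul {ι κ μ : Type*} [Fintype κ] {k l m k' l' m' : ℕ}
    {M : Matrix (Fin (m + m') → ι) (Fin (l + l') → κ) ℂ}
    {M' : Matrix (Fin (l + l') → κ) (Fin (k + k') → μ) ℂ}
    {A : Matrix (Fin m → ι) (Fin l → κ) ℂ} {A' : Matrix (Fin l → κ) (Fin k → μ) ℂ}
    {B : Matrix (Fin m' → ι) (Fin l' → κ) ℂ} {B' : Matrix (Fin l' → κ) (Fin k' → μ) ℂ}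
    (h : IsKron M A B) (h' : IsKron M' A' B') : IsKron (M * M') (A * A') (B * B') := by
  intro j i
  rw [Matrix.mul_apply, Matrix.mul_apply, Matrix.mul_apply, Finset.sum_mul_sum,
    ← (Fin.appendEquiv l l').sum_comp, Fintype.sum_prod_type]
  refine Finset.sum_congr rfl fun a _ => Finset.sum_congr rfl fun b _ => ?_
  have ha : Fin.appendEquiv l l' (a, b) ∘ Fin.castAdd l' = a := by
    funext x; simp [Fin.appendEquiv]
  have hb : Fin.appendEquiv l l' (a, b) ∘ Fin.natAdd l = b := by
    funext x; simp [Fin.appendEquiv]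
  rw [h, h', ha, hb]
  ring

theorem IsKron.eq {ι κ : Type*} {k l k' l' : ℕ}
    {M M' : Matrix (Fin (l + l') → ι) (Fin (k + k') → κ) ℂ}
    {A : Matrix (Fin l → ι) (Fin k → κ) ℂ} {B : Matrix (Fin l' → ι) (Fin k' → κ) ℂ}
    (h : IsKron M A B) (h' : IsKron M' A B) : M = M' := by
  ext j i
  rw [h, h']

theorem isKron_tpow {ι κ : Type*} (u : Matrix ι κ ℂ) (k k' : ℕ) :
    IsKron (tpow u (k + k')) (tpow u k) (tpow u k') := by
  intro j i
  simp [tpow_apply, Fin.prod_univ_add]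

theorem isKron_T (N : ℕ) {k l k' l' : ℕ} (p : PLin k l) (q : PLin k' l') :
    IsKron (T N (tensorLin p q)) (T N p) (T N q) :=
  T_tensorLin N p q

/-! ### Families of linear combinations that depend rationally on a parameter -/

/-- Functions of the form `P(d) / (d (1 - d))^a` with a polynomial `P`. -/
def IsRat (f : ℂ → ℂ) : Prop :=
  ∃ (P : Polynomial ℂ) (a : ℕ), ∀ d, d ≠ 0 → d ≠ 1 → f d * (d * (1 - d)) ^ a = P.eval d

theorem IsRat.const (x : ℂ) : IsRat fun _ => x := ⟨.C x, 0, by simp⟩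

theorem IsRat.id : IsRat fun d => d := ⟨.X, 0, by simp⟩

theorem IsRat.add {f g : ℂ → ℂ} : IsRat f → IsRat g → IsRat fun d => f d + g d := by
  rintro ⟨P, a, hP⟩ ⟨Q, b, hQ⟩
  refine ⟨P * (.X * (1 - .X)) ^ b + Q * (.X * (1 - .X)) ^ a, a + b, fun d h0 h1 => ?_⟩
  simp only [Polynomial.eval_add, Polynomial.eval_mul, Polynomial.eval_pow, Polynomial.eval_sub,
    Polynomial.eval_X, Polynomial.eval_one, ← hP d h0 h1, ← hQ d h0 h1]
  ring

theorem IsRat.mul {f g : ℂ → ℂ} : IsRat f → IsRat g → IsRat fun d => f d * g d := by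
  rintro ⟨P, a, hP⟩ ⟨Q, b, hQ⟩
  refine ⟨P * Q, a + b, fun d h0 h1 => ?_⟩
  simp only [Polynomial.eval_mul, ← hP d h0 h1, ← hQ d h0 h1]
  ring

theorem IsRat.pow {f : ℂ → ℂ} (h : IsRat f) (m : ℕ) : IsRat fun d => f d ^ m := by
  induction m with
  | zero => simpa using IsRat.const 1
  | succ m ih => simpa only [pow_succ] using ih.mul h

theorem IsRat.sum {ι : Type*} (s : Finset ι) {f : ι → ℂ → ℂ} (h : ∀ i, IsRat (f i)) :
    IsRat fun d => ∑ i ∈ s, f i d := by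
  classical
  induction s using Finset.induction_on with
  | empty => simpa using IsRat.const 0
  | insert a s ha ih => simpa only [Finset.sum_insert ha] using (h a).add ih

theorem IsRat.prod {ι : Type*} (s : Finset ι) {f : ι → ℂ → ℂ} (h : ∀ i, IsRat (f i)) :
    IsRat fun d => ∏ i ∈ s, f i d := by
  classical
  induction s using Finset.induction_on with
  | empty => simpa using IsRat.const 1
  | insert a s ha ih => simpa only [Finset.prod_insert ha] using (h a).mul ih

/-- `n = N - 1` as a function of `d = ±1/√N`. -/
def nPar (d : ℂ) : ℂ := 1 / d ^ 2 - 1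

/-- The coefficient `c` as a function of `d`. -/
def cPar (d : ℂ) : ℂ := -d ^ 2 / (1 - d)

theorem isRat_nPar : IsRat nPar := by
  refine ⟨(1 - .X ^ 2) * (1 - .X) ^ 2, 2, fun d h0 h1 => ?_⟩
  simp only [Polynomial.eval_mul, Polynomial.eval_pow, Polynomial.eval_sub,
    Polynomial.eval_X, Polynomial.eval_one, nPar]
  field_simp

theorem isRat_cPar : IsRat cPar := by
  refine ⟨-.X ^ 3, 1, fun d h0 h1 => ?_⟩
  have : 1 - d ≠ 0 := sub_ne_zero.2 h1.symm
  simp only [Polynomial.eval_neg, Polynomial.eval_pow, Polynomial.eval_X, cPar]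
  field_simp

theorem dCoeff_injective : Function.Injective (dCoeff 1) := by
  intro m m' h
  have := congrArg (· ^ 2) h
  simp only [dCoeff_sq] at this
  have h1 := natCast_add_one_ne_zero m
  have h2 := natCast_add_one_ne_zero m'
  field_simp at this
  have h3 : (m' : ℂ) = m := by linear_combination this
  exact_mod_cast h3.symm

theorem dCoeff_ne_zero (ε : ℤˣ) (n : ℕ) : dCoeff ε n ≠ 0 := by
  intro h
  have := dCoeff_sq ε n
  rw [h] at this
  have h1 := natCast_add_one_ne_zero n
  field_simp at this
  simp at this

theorem dCoeff_ne_one (ε : ℤˣ) {n : ℕ} (hn : 1 ≤ n) : dCoeff ε n ≠ 1 := by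
  intro h
  have := dCoeff_sq ε n
  rw [h] at this
  have h1 := natCast_add_one_ne_zero n
  field_simp at this
  have h2 : (n : ℂ) = 0 := by linear_combination this
  have : n = 0 := by exact_mod_cast h2
  omega

theorem nPar_dCoeff (ε : ℤˣ) (n : ℕ) : nPar (dCoeff ε n) = n := by
  rw [nPar, dCoeff_sq]
  simp

/-- From `n = (1 - d)(1 + d)/d^2` the factor `1 + d` in `c` cancels, which leaves no pole at `d =
-1`. -/
theorem cPar_dCoeff (ε : ℤˣ) {n : ℕ} (hn : 1 ≤ n) : cPar (dCoeff ε n) = cCoeff ε n := by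
  have h0 : (n : ℂ) ≠ 0 := by exact_mod_cast (by omega : n ≠ 0)
  have h1 := natCast_add_one_ne_zero n
  have h2 : 1 - dCoeff ε n ≠ 0 := sub_ne_zero.2 (dCoeff_ne_one ε hn).symm
  have h3 := dCoeff_sq ε n
  have h4 : dCoeff ε n ^ 2 * (n + 1) = 1 := by rw [h3]; field_simp
  rw [cPar, cCoeff]
  field_simp
  linear_combination -h4

/-- The numerator is a polynomial with infinitely many roots `1/√(m + 1)`. The plus sign alone
suffices to reach every admissible `d`, including negative values. -/
theorem IsRat.eq_zero {f : ℂ → ℂ} (hf : IsRat f) (m₀ : ℕ)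
    (h : ∀ m, m₀ ≤ m → f (dCoeff 1 m) = 0) {d : ℂ} (h0 : d ≠ 0) (h1 : d ≠ 1) : f d = 0 := by
  obtain ⟨P, a, hP⟩ := hf
  have hP0 : P = 0 := by
    refine Polynomial.eq_zero_of_infinite_isRoot P ?_
    -- The value `m = 0` is excluded because it gives `d = 1`, a zero of the denominator.
    refine Set.Infinite.mono ?_ ((Set.Ici_infinite (max m₀ 1)).image
      dCoeff_injective.injOn)
    rintro _ ⟨m, hm, rfl⟩
    have hm' := max_le_iff.1 (Set.mem_Ici.1 hm)
    change P.eval _ = 0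
    rw [← hP _ (dCoeff_ne_zero 1 m) (dCoeff_ne_one 1 hm'.2), h m hm'.1, zero_mul]
  have := hP d h0 h1
  rw [hP0, Polynomial.eval_zero, mul_eq_zero] at this
  exact this.resolve_right (pow_ne_zero _ (mul_ne_zero h0 (sub_ne_zero.2 h1.symm)))

/-- Families of linear combinations whose coefficients are rational functions. -/
def RatFam {k l : ℕ} (F : ℂ → PLin k l) : Prop := ∀ r, IsRat fun d => F d r

theorem RatFam.const {k l : ℕ} (p : PLin k l) : RatFam fun _ => p := fun r => .const (p r)

theorem RatFam.single {k l : ℕ} (p : Part k l) {f : ℂ → ℂ} (hf : IsRat f) :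
    RatFam fun d => Finsupp.single p (f d) := by
  classical
  intro r
  simp only [Finsupp.single_apply]
  split_ifs
  · exact hf
  · exact .const 0

theorem RatFam.sum {ι : Type*} (s : Finset ι) {k l : ℕ} {F : ι → ℂ → PLin k l}
    (h : ∀ i, RatFam (F i)) : RatFam fun d => ∑ i ∈ s, F i d := by
  intro r
  simp only [Finsupp.finsetSum_apply]
  exact IsRat.sum s fun i => h i r

theorem RatFam.smul {k l : ℕ} {F : ℂ → PLin k l} {f : ℂ → ℂ} (hf : IsRat f) (hF : RatFam F) :
    RatFam fun d => f d • F d := fun r => hf.mul (hF r)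

theorem RatFam.sub {k l : ℕ} {F G : ℂ → PLin k l} (hF : RatFam F) (hG : RatFam G) :
    RatFam fun d => F d - G d := by
  intro r
  have := (hF r).add ((IsRat.const (-1)).mul (hG r))
  simpa [sub_eq_add_neg] using this

theorem RatFam.tensor {k l k' l' : ℕ} {F : ℂ → PLin k l} {G : ℂ → PLin k' l'} (hF : RatFam F)
    (hG : RatFam G) : RatFam fun d => tensorLin (F d) (G d) := by
  have : ∀ d, tensorLin (F d) (G d) =
      ∑ a, ∑ b, Finsupp.single (Part.tensor a b) (F d a * G d b) := by
    intro d
    rw [tensorLin, Finsupp.sum_fintype _ _ (by simp)]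
    refine Finset.sum_congr rfl fun a _ => ?_
    rw [Finsupp.sum_fintype _ _ (by simp)]
  simp only [this]
  exact .sum _ fun a => .sum _ fun b => .single _ ((hF a).mul (hG b))

/-- Composition with an arbitrary parameter. -/
def compPar (x : ℂ) {k l m : ℕ} (q : PLin l m) (p : PLin k l) : PLin k m :=
  q.sum fun b y => p.sum fun a z =>
    Finsupp.single (Part.comp b a) (y * z * x ^ Part.loops b a)

theorem compPar_natCast (N : ℕ) {k l m : ℕ} (q : PLin l m) (p : PLin k l) :
    compPar N q p = compLin N q p := rfl

theorem RatFam.comp {k l m : ℕ} {x : ℂ → ℂ} {G : ℂ → PLin l m} {F : ℂ → PLin k l} (hx : IsRat x)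
    (hG : RatFam G) (hF : RatFam F) : RatFam fun d => compPar (x d) (G d) (F d) := by
  have : ∀ d, compPar (x d) (G d) (F d) =
      ∑ b, ∑ a, Finsupp.single (Part.comp b a) (G d b * F d a * x d ^ Part.loops b a) := by
    intro d
    rw [compPar, Finsupp.sum_fintype _ _ (by simp)]
    refine Finset.sum_congr rfl fun a _ => ?_
    rw [Finsupp.sum_fintype _ _ (by simp)]
  simp only [this]
  exact .sum _ fun b => .sum _ fun a => .single _ (((hG b).mul (hF a)).mul (hx.pow _))

/-- The linear extension of the reflection of partitions. -/
def revLin {k l : ℕ} : PLin k l →ₗ[ℂ] PLin l k := Finsupp.lmapDomain ℂ ℂ Part.invol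

theorem revLin_single {k l : ℕ} (p : Part k l) (x : ℂ) :
    revLin (Finsupp.single p x) = Finsupp.single (Part.invol p) x :=
  Finsupp.mapDomain_single

theorem T_revLin (N : ℕ) {k l : ℕ} (p : PLin k l) : T N (revLin p) = (T N p)ᵀ := by
  induction p using Finsupp.induction_linear with
  | zero => simp
  | add p q hp hq => simp only [map_add, hp, hq, Matrix.transpose_add]
  | single a x => rw [revLin_single, T_single, T_single, partMatrix_invol, Matrix.transpose_smul]

theorem RatFam.rev {k l : ℕ} {F : ℂ → PLin k l} (hF : RatFam F) :
    RatFam fun d => revLin (F d) := by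
  have : ∀ d, revLin (F d) = ∑ a, Finsupp.single (Part.invol a) (F d a) := by
    intro d
    exact (Finsupp.sum_fintype _ _ (by simp))
  simp only [this]
  exact .sum _ fun a => .single _ (hF a)

theorem isRat_blockWeight {α : Type} (B I : Finset α) :
    IsRat fun d => blockWeight (nPar d) (cPar d) d B I := by
  unfold blockWeight
  split_ifs
  · exact (isRat_nPar.mul (isRat_cPar.pow _)).add (IsRat.id.pow _)
  · exact isRat_cPar.pow _

/-- The map `calV` as a function of the parameter `d`. -/
abbrev parV (d : ℂ) {k l : ℕ} : PLin k l →ₗ[ℂ] PLin k l := expandLin (nPar d) (cPar d) d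

theorem parV_dCoeff (ε : ℤˣ) {n : ℕ} (hn : 1 ≤ n) {k l : ℕ} :
    parV (dCoeff ε n) (k := k) (l := l) = calV ε n := by
  rw [parV, nPar_dCoeff, cPar_dCoeff ε hn, expandLin_eq_calV]

theorem RatFam.parV {k l : ℕ} {F : ℂ → PLin k l} (hF : RatFam F) :
    RatFam fun d => parV d (F d) := by
  classical
  have : ∀ d, PartQG.parV d (F d) = ∑ a, F d a • expand (nPar d) (cPar d) d a := by
    intro d
    rw [PartQG.parV, expandLin, Finsupp.linearCombination_apply, Finsupp.sum_fintype _ _ (by simp)]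
  simp only [this]
  exact .sum _ fun a => .smul (hF a) (.sum _ fun I => .single _ (.prod _ fun B =>
    isRat_blockWeight _ _))

/-- Two rational families agree if their images under `T` agree for infinitely many values of the
parameter. -/
theorem RatFam.eq_of_T {k l : ℕ} {F G : ℂ → PLin k l} (hF : RatFam F) (hG : RatFam G)
    (h : ∀ n : ℕ, 1 ≤ n → T n (F (dCoeff 1 n)) = T n (G (dCoeff 1 n))) {d : ℂ} (h0 : d ≠ 0)
    (h1 : d ≠ 1) : F d = G d := by
  rw [← sub_eq_zero]
  ext r
  -- For `m ≥ k + l + 1` both `T_injective` and the condition `1 ≤ m` of `h` are available.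
  refine (hF.sub hG r).eq_zero (k + l + 1) (fun m hm => ?_) h0 h1
  have : F (dCoeff 1 m) - G (dCoeff 1 m) = 0 := by
    rw [sub_eq_zero]
    exact T_injective (by omega) (h m (by omega))
  exact DFunLike.congr_fun this r

/-! ### Compatibility of `calV` with the category operations -/

/-- Under `T` this only says that `V^{⊗(k+k')}` is the Kronecker product of `V^{⊗k}` and `V^{⊗k'}`;
the rest is the passage from infinitely many `d` to all. -/
theorem parV_tensorLin {k l k' l' : ℕ} (p : PLin k l) (q : PLin k' l') {d : ℂ} (h0 : d ≠ 0)
    (h1 : d ≠ 1) : parV d (tensorLin p q) = tensorLin (parV d p) (parV d q) := by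
  refine RatFam.eq_of_T (RatFam.const _).parV (.tensor (RatFam.const _).parV
    (RatFam.const _).parV) (fun n hn => ?_) h0 h1
  refine IsKron.eq ?_ (isKron_T n _ _)
  simp only [parV_dCoeff 1 hn, T_calV]
  exact ((isKron_tpow _ _ _).mul (isKron_T _ _ _)).mul (isKron_tpow _ _ _)

theorem parV_revLin {k l : ℕ} (p : PLin k l) {d : ℂ} (h0 : d ≠ 0)
    (h1 : d ≠ 1) : parV d (revLin p) = revLin (parV d p) := by
  refine RatFam.eq_of_T (RatFam.const _).parV (RatFam.const _).parV.rev (fun n hn => ?_) h0 h1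
  simp only [parV_dCoeff 1 hn, T_calV, T_revLin, Vmat_conjTranspose, tpow_transpose,
    Matrix.transpose_mul, Matrix.transpose_transpose, Matrix.mul_assoc]

/-- The partition version of the projection onto the complement of the trivial
subrepresentation, for `d = ±1/√N`. -/
def projPar (d : ℂ) : PLin 1 1 := idPart - d ^ 2 • Finsupp.single ⊥ 1

/-- Tensor powers of linear combinations of partitions. -/
def powLin (p : PLin 1 1) : ∀ k : ℕ, PLin k k
  | 0 => Finsupp.single ⊤ 1
  | k + 1 => tensorLin (powLin p k) p

theorem RatFam.pow {F : ℂ → PLin 1 1} (hF : RatFam F) (k : ℕ) :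
    RatFam fun d => powLin (F d) k := by
  induction k with
  | zero => exact .const _
  | succ k ih => exact ih.tensor hF

theorem ratFam_projPar : RatFam projPar :=
  (RatFam.const _).sub (.smul (IsRat.id.pow 2) (.const _))

theorem T_powLin (N : ℕ) (p : PLin 1 1) (M : Matrix (Fin N) (Fin N) ℂ) (h : T N p = tpow M 1)
    (k : ℕ) : T N (powLin p k) = tpow M k := by
  induction k with
  | zero =>
    ext j i
    simp [powLin, T_single, tpow_zero, partMatrix_apply, Compat]
  | succ k ih =>
    refine IsKron.eq (isKron_T N _ _) ?_
    rw [ih, h]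
    exact isKron_tpow M k 1

theorem T_projPar (ε : ℤˣ) {n : ℕ} (hn : 1 ≤ n) :
    T (n + 1) (projPar (dCoeff ε n)) = tpow ((Vmat ε n)ᴴ * Vmat ε n) 1 := by
  rw [conjTranspose_mul_Vmat ε hn, projPar, dCoeff_sq]
  ext j i
  have h1 : Compat (⊤ : Part 1 1) (Sum.elim i j) ↔ j 0 = i 0 := by
    simp [Compat, eq_comm]
  have h2 : Compat (⊥ : Part 1 1) (Sum.elim i j) := by
    rintro x y rfl; rfl
  simp only [map_sub, map_smul, idPart, T_single, one_smul, Matrix.sub_apply, Matrix.smul_apply,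
    partMatrix_apply, h1, h2, tpow_apply, Matrix.one_apply]
  simp

/-- The product of two compressions `V T_q V^*` and `V T_p V^*` has the projection `V^* V` in the
middle, so the preimage needs `projPar` on each of the `l` middle strands. A closed component counts
`N` before compression and `N - 1` after it, hence the two parameters. -/
theorem parV_comp {k l m : ℕ} (q : PLin l m) (p : PLin k l) {d : ℂ} (h0 : d ≠ 0) (h1 : d ≠ 1) :
    parV d (compPar (nPar d + 1) q (compPar (nPar d + 1) (powLin (projPar d) l) p)) =
      compPar (nPar d) (parV d q) (parV d p) := by
  have hn : IsRat fun d => nPar d + 1 := isRat_nPar.add (.const 1)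
  refine RatFam.eq_of_T (RatFam.parV (.comp hn (.const _) (.comp hn (ratFam_projPar.pow l)
    (.const _)))) (.comp isRat_nPar (RatFam.const _).parV (RatFam.const _).parV)
    (fun n hn => ?_) h0 h1
  have e : nPar (dCoeff 1 n) + 1 = (n + 1 : ℕ) := by rw [nPar_dCoeff]; push_cast; rfl
  rw [e, nPar_dCoeff]
  simp only [parV_dCoeff 1 hn, compPar_natCast, T_compLin, T_calV,
    T_powLin _ _ _ (T_projPar 1 hn)]
  rw [tpow_mul _ _ fun _ _ _ _ => Commute.all _ _]
  simp only [Matrix.mul_assoc]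

theorem parV_idPart {d : ℂ} (h0 : d ≠ 0) (h1 : d ≠ 1) : parV d idPart = idPart := by
  refine RatFam.eq_of_T (RatFam.const _).parV (RatFam.const _) (fun n hn => ?_) h0 h1
  have hT : ∀ N, T N idPart = 1 := by
    intro N
    ext j i
    have h1 : Compat (⊤ : Part 1 1) (Sum.elim i j) ↔ j = i := by
      simp [Compat, eq_comm, funext_iff]
    simp [idPart, T_single, partMatrix_apply, h1, Matrix.one_apply]
  rw [parV_dCoeff 1 hn, T_calV, hT, hT, Matrix.mul_one, ← tpow_mul _ _ fun _ _ _ _ => Commute.all _ _,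
    Vmat_mul_conjTranspose 1 hn, tpow_one]

theorem T_pairPart (N : ℕ) (j : Fin 2 → Fin N) (i : Fin 0 → Fin N) :
    T N pairPart j i = (1 : Matrix (Fin N) (Fin N) ℂ) (j 0) (j 1) := by
  have h1 : Compat (⊤ : Part 0 2) (Sum.elim i j) ↔ j 0 = j 1 := by
    simp [Compat, Fin.forall_fin_two, eq_comm]
  simp [pairPart, T_single, partMatrix_apply, h1, Matrix.one_apply]

/-- Applying `V ⊗ V` to the pair vector gives the entries of `V V^t`, which is the identity. -/
theorem parV_pairPart {d : ℂ} (h0 : d ≠ 0) (h1 : d ≠ 1) : parV d pairPart = pairPart := by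
  refine RatFam.eq_of_T (RatFam.const _).parV (RatFam.const _) (fun n hn => ?_) h0 h1
  rw [parV_dCoeff 1 hn, T_calV]
  ext j i
  rw [T_pairPart, ← Vmat_mul_conjTranspose 1 hn, Vmat_conjTranspose, Matrix.mul_apply,
    Matrix.mul_apply]
  simp only [tpow_zero, mul_one, Matrix.mul_apply, T_pairPart, Finset.univ_unique,
    Finset.sum_singleton]
  rw [← (finTwoArrowEquiv (Fin (n + 1))).symm.sum_comp, Fintype.sum_prod_type]
  simp [tpow_apply, Matrix.one_apply, finTwoArrowEquiv]

/-- Complex conjugation is not rational in `d`. The involution is therefore split into the linear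
reflection, covered by the rational argument, and conjugation of coefficients, which commutes with
`calV` because `c` and `d` are real. -/
theorem involLin_eq_revLin {k l : ℕ} (p : PLin k l) :
    involLin p = revLin (p.mapRange star (star_zero ℂ)) := by
  change _ = Finsupp.sum _ _
  rw [Finsupp.sum_mapRange_index (by simp)]
  rfl

theorem star_blockCoeff (ε : ℤˣ) (n : ℕ) {α : Type} (B I : Finset α) :
    star (blockCoeff ε n B I) = blockCoeff ε n B I := by
  unfold blockCoeff
  split_ifs
  · simp only [star_add, star_mul', star_pow, star_cCoeff, star_dCoeff, star_natCast]
  · rw [star_pow, star_cCoeff]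

theorem calV_mapRange_star (ε : ℤˣ) (n : ℕ) {k l : ℕ} (p : PLin k l) :
    calV ε n (p.mapRange star (star_zero ℂ)) =
      (calV ε n p).mapRange star (star_zero ℂ) := by
  classical
  induction p using Finsupp.induction_linear with
  | zero => simp
  | add p q hp hq => rw [Finsupp.mapRange_add (fun x y => star_add x y), map_add, map_add,
      Finsupp.mapRange_add (fun x y => star_add x y), hp, hq]
  | single a x =>
    rw [Finsupp.mapRange_single, calV, Finsupp.linearCombination_single,
      Finsupp.linearCombination_single]
    ext r
    rw [Finsupp.mapRange_apply, Finsupp.smul_apply, Finsupp.smul_apply, smul_eq_mul, smul_eq_mul,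
      star_mul']
    congr 1
    simp only [calVPart, Finsupp.finsetSum_apply, Finsupp.single_apply, star_sum,
      apply_ite star, star_prod, star_blockCoeff, star_zero]

theorem calV_involLin (ε : ℤˣ) {n : ℕ} (hn : 1 ≤ n) {k l : ℕ} (p : PLin k l) :
    calV ε n (involLin p) = involLin (calV ε n p) := by
  rw [involLin_eq_revLin, involLin_eq_revLin, ← calV_mapRange_star, ← parV_dCoeff ε hn,
    ← parV_dCoeff ε hn, parV_revLin _ (dCoeff_ne_zero ε n) (dCoeff_ne_one ε hn)]

/-! ### Partitions forced into the category by the double singleton -/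

section

variable {N : ℕ} {K : ∀ k l : ℕ, Submodule ℂ (PLin k l)}

/-- The pair partition closed off by its reflection is a nonzero multiple of the empty diagram. This
is the base case for tensor powers. -/
theorem IsLinCat.empty_mem (hK : IsLinCat N K) (hN : N ≠ 0) :
    (Finsupp.single ⊤ 1 : PLin 0 0) ∈ K 0 0 := by
  have h := hK.comp_mem _ _ (hK.invol_mem _ hK.pair_mem) hK.pair_mem
  rw [pairPart, involLin, Finsupp.sum_single_index (by simp), compLin,
    Finsupp.sum_single_index (by simp), Finsupp.sum_single_index (by simp)] at h
  have e : ∀ p : Part 0 0, p = ⊤ := fun p => by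
    ext x
    rcases x with x | x <;> exact x.elim0
  rw [e (Part.comp _ _), star_one, one_mul, one_mul] at h
  set x := (N : ℂ) ^ Part.loops (Part.invol (⊤ : Part 0 2)) (⊤ : Part 0 2)
  have hx : x ≠ 0 := pow_ne_zero _ (Nat.cast_ne_zero.2 hN)
  have := (K 0 0).smul_mem x⁻¹ h
  rwa [Finsupp.smul_single, smul_eq_mul, inv_mul_cancel₀ hx] at this

/-- The diagram `id ⊗ ⊓^*`. -/
@[reducible]
def idTensorCap : Part 3 1 :=
  Part.tensor (k := 1) (l := 1) (k' := 2) (l' := 0) ⊤ (Part.invol ⊤)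

/-- The diagram `↑ ⊗ ↑ ⊗ id`. -/
@[reducible]
def singletonsTensorId : Part 1 3 := Part.tensor (k := 0) (l := 2) (k' := 1) (l' := 1) ⊥ ⊤

theorem compat_idTensorCap {β : Type*} (s : Fin 3 → β) (j : Fin 1 → β) :
    Compat idTensorCap (Sum.elim s j) ↔ s 0 = j 0 ∧ s 1 = s 2 := by
  refine (compat_tensor (k := 1) (l := 1) (k' := 2) (l' := 0) ⊤ (Part.invol ⊤) s j).trans ?_
  refine and_congr ⟨fun h => h (.inl 0) (.inr 0) trivial, ?_⟩
    ⟨fun h => h (.inl 0) (.inl 1) trivial, ?_⟩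
  · rintro h (x | x) (y | y) _ <;> fin_cases x <;> fin_cases y <;>
      first | rfl | exact h | exact h.symm
  · rintro h (x | x) (y | y) _ <;> fin_cases x <;> fin_cases y <;>
      first | rfl | exact h | exact h.symm

theorem compat_singletonsTensorId {β : Type*} (i : Fin 1 → β) (s : Fin 3 → β) :
    Compat singletonsTensorId (Sum.elim i s) ↔ i 0 = s 2 := by
  refine (compat_tensor (k := 0) (l := 2) (k' := 1) (l' := 1) ⊥ ⊤ i s).trans ?_
  constructor
  · exact fun h => h.2 (.inl 0) (.inr 0) trivial
  · refine fun h => ⟨?_, ?_⟩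
    · rintro x y rfl; rfl
    · rintro (x | x) (y | y) _ <;> fin_cases x <;> fin_cases y <;>
        first | rfl | exact h | exact h.symm

theorem comp_cap_doubleSingleton :
    Part.comp idTensorCap singletonsTensorId = ⊥ := by
  -- This labelling is compatible with the glued diagram and separates its upper point from its
  -- lower point, so they are not connected.
  have h : Compat (Part.glue idTensorCap singletonsTensorId)
      (Sum.elim (fun _ => true) (Sum.elim ![false, true, true] fun _ => false)) := by
    rw [compat_glue, compat_idTensorCap, compat_singletonsTensorId]
    exact ⟨⟨rfl, rfl⟩, rfl⟩
  rw [eq_bot_iff]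
  rintro (x | x) (y | y) hxy
  · exact congrArg Sum.inl (Subsingleton.elim x y)
  · exact absurd (h _ _ hxy) (by simp)
  · exact absurd (h _ _ hxy) (by simp)
  · exact congrArg Sum.inr (Subsingleton.elim x y)

/-- The quotient map is itself a compatible labelling, so `compat_glue` reads off the connections:
the first middle point is joined to the lower point, the other two to the upper point. -/
theorem loops_cap_doubleSingleton :
    Part.loops idTensorCap singletonsTensorId = 0 := by
  set r := Part.glue idTensorCap singletonsTensorId
  let i : Fin 1 → Quotient r := fun a => Quotient.mk r (.inl a)
  let s : Fin 3 → Quotient r := fun a => Quotient.mk r (.inr (.inl a))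
  let j : Fin 1 → Quotient r := fun a => Quotient.mk r (.inr (.inr a))
  have h : Compat r (Sum.elim i (Sum.elim s j)) := by
    have e : Sum.elim i (Sum.elim s j) = Quotient.mk r := by
      funext x
      rcases x with x | x | x <;> rfl
    rw [e]
    exact fun x y hxy => Quotient.sound hxy
  replace h := (compat_glue _ _ i s j).1 h
  rw [compat_idTensorCap, compat_singletonsTensorId] at h
  obtain ⟨⟨h1, h2⟩, h3⟩ := h
  rw [Part.loops, Nat.card_eq_zero]
  left
  rw [isEmpty_subtype]
  intro c hc
  induction c using Quotient.inductionOn with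
  | h x =>
    rcases x with x | x | x
    · exact hc (.inl x) rfl
    · fin_cases x
      · exact hc (.inr 0) h1.symm
      · exact hc (.inl 0) (h3.trans h2.symm)
      · exact hc (.inl 0) h3
    · exact hc (.inr x) rfl

/-- One leg of the double singleton is rotated to the upper row by composing `↑ ⊗ ↑ ⊗ id` with `id ⊗
⊓^*`. -/
theorem IsLinCat.singletons_mem (hK : IsLinCat N K) (hS : doubleSingleton ∈ K 0 2) :
    (Finsupp.single ⊥ 1 : PLin 1 1) ∈ K 1 1 := by
  have h := hK.comp_mem (k := 0 + 1) (l := 2 + 1) (m := 1 + 0) _ _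
    (hK.tensor_mem (k := 1) (l := 1) (k' := 2) (l' := 0) _ _ hK.id_mem
      (hK.invol_mem (k := 0) (l := 2) _ hK.pair_mem))
    (hK.tensor_mem (k := 0) (l := 2) (k' := 1) (l' := 1) _ _ hS hK.id_mem)
  rw [pairPart, involLin, Finsupp.sum_single_index (by simp), idPart, doubleSingleton,
    tensorLin, tensorLin, Finsupp.sum_single_index (by simp), Finsupp.sum_single_index (by simp),
    Finsupp.sum_single_index (by simp), Finsupp.sum_single_index (by simp), compLin,
    Finsupp.sum_single_index (by simp), Finsupp.sum_single_index (by simp)] at h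
  erw [comp_cap_doubleSingleton, loops_cap_doubleSingleton] at h
  simpa using h

theorem IsLinCat.powLin_mem (hK : IsLinCat N K) (hN : N ≠ 0) {p : PLin 1 1} (hp : p ∈ K 1 1)
    (k : ℕ) : powLin p k ∈ K k k := by
  induction k with
  | zero => exact hK.empty_mem hN
  | succ k ih => exact hK.tensor_mem _ _ ih hp

end

theorem isLinCat_calVCat (ε : ℤˣ) {n : ℕ} (hn : 1 ≤ n) {K : ∀ k l : ℕ, Submodule ℂ (PLin k l)}
    (hK : IsLinCat (n + 1) K) (hS : doubleSingleton ∈ K 0 2) : IsLinCat n (calVCat ε n K) := by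
  have h0 := dCoeff_ne_zero ε n
  have h1 := dCoeff_ne_one ε hn
  have e : nPar (dCoeff ε n) + 1 = (n + 1 : ℕ) := by rw [nPar_dCoeff]; push_cast; rfl
  refine ⟨⟨_, hK.id_mem, ?_⟩, ⟨_, hK.pair_mem, ?_⟩, ?_, ?_, ?_⟩
  · rw [← parV_dCoeff ε hn, parV_idPart h0 h1]
  · rw [← parV_dCoeff ε hn, parV_pairPart h0 h1]
  · rintro k l k' l' _ _ ⟨p, hp, rfl⟩ ⟨q, hq, rfl⟩
    refine ⟨_, hK.tensor_mem _ _ hp hq, ?_⟩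
    simp only [← parV_dCoeff ε hn, parV_tensorLin _ _ h0 h1]
  · rintro k l m _ _ ⟨q, hq, rfl⟩ ⟨p, hp, rfl⟩
    have hP : powLin (projPar (dCoeff ε n)) l ∈ K l l :=
      hK.powLin_mem n.succ_ne_zero (sub_mem hK.id_mem
        ((K 1 1).smul_mem _ (hK.singletons_mem hS))) l
    -- The preimage of the composite is `q P^{⊗l} p`, not `q p`.
    refine ⟨_, hK.comp_mem _ _ hq (hK.comp_mem _ _ hP hp), ?_⟩
    have := parV_comp q p h0 h1
    rw [e, nPar_dCoeff] at this
    simpa only [parV_dCoeff ε hn, compPar_natCast] using this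
  · rintro k l _ ⟨p, hp, rfl⟩
    exact ⟨_, hK.invol_mem _ hp, calV_involLin ε hn p⟩

/-! ### Intertwiners of a compressed representation -/

theorem scal_mul (A : Type*) [Semiring A] [Algebra ℂ A] {ι κ μ : Type*} [Fintype κ]
    (M : Matrix ι κ ℂ) (M' : Matrix κ μ ℂ) : scal A (M * M') = scal A M * scal A M' :=
  Matrix.map_mul

theorem scal_one (A : Type*) [Semiring A] [Algebra ℂ A] {ι : Type*} [DecidableEq ι] :
    scal A (1 : Matrix ι ι ℂ) = 1 :=
  Matrix.map_one _ (map_zero _) (map_one _)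

theorem tpow_scal (A : Type*) [Semiring A] [Algebra ℂ A] {ι κ : Type*} (M : Matrix ι κ ℂ) (k : ℕ) :
    tpow (scal A M) k = scal A (tpow M k) := by
  ext i j
  simp only [tpow, scal, Matrix.of_apply, Matrix.map_apply, map_list_prod, List.map_ofFn]
  rfl

theorem tpow_scal_mul {A : Type*} [Semiring A] [Algebra ℂ A] {ι κ μ : Type*} [Fintype κ]
    (M : Matrix ι κ ℂ) (u : Matrix κ μ A) (k : ℕ) :
    tpow (scal A M * u) k = scal A (tpow M k) * tpow u k := by
  rw [tpow_mul (scal A M) u fun _ _ _ _ => Algebra.commutes _ _, tpow_scal]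

theorem tpow_mul_scal {A : Type*} [Semiring A] [Algebra ℂ A] {ι κ μ : Type*} [Fintype κ]
    (u : Matrix ι κ A) (M : Matrix κ μ ℂ) (k : ℕ) :
    tpow (u * scal A M) k = tpow u k * scal A (tpow M k) := by
  rw [tpow_mul u (scal A M) fun _ _ _ _ => (Algebra.commutes _ _).symm, tpow_scal]

/-- Intertwiners of the compression of `u` by a coisometry `V` whose range projection `V^* V` is an
intertwiner of `u`. -/
theorem mor_compression {A : Type*} [Semiring A] [Algebra ℂ A] {n N : ℕ}
    (u : Matrix (Fin N) (Fin N) A) (V : Matrix (Fin n) (Fin N) ℂ) (W : Matrix (Fin N) (Fin n) ℂ)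
    (hV : V * W = 1) (hu : scal A (W * V) * u = u * scal A (W * V)) (k l : ℕ) :
    Mor (scal A V * u * scal A W) k l =
      {S | ∃ R ∈ Mor u k l, tpow V l * R * tpow W k = S} := by
  have hT : ∀ k, tpow (scal A V * u * scal A W) k =
      scal A (tpow V k) * tpow u k * scal A (tpow W k) := by
    intro k
    rw [tpow_mul_scal, tpow_scal_mul]
  have hVW : ∀ k, tpow V k * tpow W k = 1 := by
    intro k
    rw [← tpow_mul _ _ fun _ _ _ _ => Commute.all _ _, hV, tpow_one]
  have hWV : ∀ k, scal A (tpow W k * tpow V k) * tpow u k =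
      tpow u k * scal A (tpow W k * tpow V k) := by
    intro k
    rw [← tpow_mul _ _ fun _ _ _ _ => Commute.all _ _, ← tpow_scal_mul, hu, tpow_mul_scal]
  have hr : ∀ k, scal A (tpow W k * tpow V k) * scal A (tpow W k) = scal A (tpow W k) := by
    intro k
    rw [← scal_mul, Matrix.mul_assoc, hVW, Matrix.mul_one]
  have hl : ∀ k, scal A (tpow V k) * scal A (tpow W k * tpow V k) = scal A (tpow V k) := by
    intro k
    rw [← scal_mul, ← Matrix.mul_assoc, hVW, Matrix.one_mul]
  ext S
  simp only [Mor, Set.mem_ofPred_eq, hT]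
  constructor
  · intro hS
    -- The lift of `S` that vanishes on the kernel of `V^{⊗k}`; compressing it gives back `S`
    -- because `V W = 1`.
    refine ⟨tpow W l * S * tpow V k, ?_, ?_⟩
    · have e1 : scal A (tpow V k) * tpow u k =
          scal A (tpow V k) * tpow u k * scal A (tpow W k) * scal A (tpow V k) := by
        rw [Matrix.mul_assoc _ (scal A (tpow W k)), ← scal_mul, Matrix.mul_assoc _ (tpow u k),
          ← hWV, ← Matrix.mul_assoc, hl]
      have e2 : tpow u l * scal A (tpow W l) =
          scal A (tpow W l) * (scal A (tpow V l) * tpow u l * scal A (tpow W l)) := by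
        rw [Matrix.mul_assoc, ← Matrix.mul_assoc (scal A (tpow W l)), ← scal_mul,
          ← Matrix.mul_assoc, hWV, Matrix.mul_assoc, hr]
      calc scal A (tpow W l * S * tpow V k) * tpow u k
          = scal A (tpow W l) * (scal A S * (scal A (tpow V k) * tpow u k)) := by
            rw [scal_mul, scal_mul]; simp only [Matrix.mul_assoc]
        _ = scal A (tpow W l) * (scal A S *
              (scal A (tpow V k) * tpow u k * scal A (tpow W k))) * scal A (tpow V k) := by
            conv_lhs => rw [e1]
            simp only [Matrix.mul_assoc]
        _ = tpow u l * scal A (tpow W l) * (scal A S * scal A (tpow V k)) := by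
            rw [hS, e2]; simp only [Matrix.mul_assoc]
        _ = tpow u l * scal A (tpow W l * S * tpow V k) := by
            rw [scal_mul, scal_mul]; simp only [Matrix.mul_assoc]
    · rw [← Matrix.mul_assoc, ← Matrix.mul_assoc, hVW, Matrix.one_mul, Matrix.mul_assoc, hVW,
        Matrix.mul_one]
  · rintro ⟨R, hR, rfl⟩
    -- The inner `W V` is moved past `u^{⊗k}` and absorbed by `W`; on the other side it is recreated
    -- from `V` and moved past `u^{⊗l}`.
    calc scal A (tpow V l * R * tpow W k) * (scal A (tpow V k) * tpow u k * scal A (tpow W k))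
        = scal A (tpow V l) * (scal A R * (scal A (tpow W k * tpow V k) * tpow u k)) *
            scal A (tpow W k) := by
          rw [scal_mul, scal_mul, scal_mul]; simp only [Matrix.mul_assoc]
      _ = scal A (tpow V l) * (scal A R * tpow u k) *
            (scal A (tpow W k * tpow V k) * scal A (tpow W k)) := by
          rw [hWV]; simp only [Matrix.mul_assoc]
      _ = scal A (tpow V l) * (tpow u l * scal A R) * scal A (tpow W k) := by rw [hr, hR]
      _ = scal A (tpow V l) * scal A (tpow W l * tpow V l) * tpow u l * scal A R *
            scal A (tpow W k) := by rw [hl]; simp only [Matrix.mul_assoc]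
      _ = scal A (tpow V l) * (tpow u l * scal A (tpow W l * tpow V l)) * scal A R *
            scal A (tpow W k) := by rw [← hWV]; simp only [Matrix.mul_assoc]
      _ = scal A (tpow V l) * tpow u l * scal A (tpow W l) * scal A (tpow V l * R * tpow W k) := by
          rw [scal_mul, scal_mul, scal_mul]; simp only [Matrix.mul_assoc]

theorem mor_restr {A : Type u} [CStarAlgebra A] {N : ℕ} (u : Matrix (Fin N) (Fin N) A)
    (k l : ℕ) : Mor (restr u) k l = Mor u k l := by
  have hinj : Function.Injective ((gen u).subtype : gen u → A) := Subtype.val_injective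
  have ht : ∀ k, (tpow (restr u) k).map (gen u).subtype = tpow u k := by
    intro k
    ext i j
    simp only [tpow, Matrix.of_apply, Matrix.map_apply, map_list_prod, List.map_ofFn]
    rfl
  have hs : ∀ {k l : ℕ} (S : Matrix (Fin l → Fin N) (Fin k → Fin N) ℂ),
      (scal (gen u) S).map (gen u).subtype = scal A S := by
    intro k l S
    ext i j
    rfl
  ext S
  simp only [Mor, Set.mem_ofPred_eq]
  rw [← (Matrix.map_injective hinj).eq_iff]
  have e := Matrix.map_mul (f := ((gen u).subtype : gen u →+* A))
    (L := scal (gen u) S) (M := tpow (restr u) k)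
  have e' := Matrix.map_mul (f := ((gen u).subtype : gen u →+* A))
    (L := tpow (restr u) l) (M := scal (gen u) S)
  have e1 : (scal (gen u) S * tpow (restr u) k).map (gen u).subtype = scal A S * tpow u k := by
    rw [← ht, ← hs S]; exact e
  have e2 : (tpow (restr u) l * scal (gen u) S).map (gen u).subtype = tpow u l * scal A S := by
    rw [← ht, ← hs S]; exact e'
  rw [e1, e2]

/-! ### Bistochastic relations and orthogonality of the compression -/

/-- The relations of `B_N^{#+}`. -/
structure IsBistoch {A : Type*} [Semiring A] [StarRing A] {N : ℕ}
    (u : Matrix (Fin N) (Fin N) A) : Prop where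
  star_apply : ∀ i j, star (u i j) = u i j
  mul_transpose : u * uᵀ = 1
  transpose_mul : uᵀ * u = 1
  sum_mul_sum : ∀ i j, (∑ a, u i a) * ∑ b, u j b = 1

section

variable {A : Type*} [Semiring A] [StarRing A] {N : ℕ} {u : Matrix (Fin N) (Fin N) A}

/-- With `r_i` the row sums, `r_i = r_i (r_i r_j) = (r_i r_i) r_j = r_j`. The common value is its
own inverse. -/
theorem IsBistoch.row_sum_eq (h : IsBistoch u) (i j : Fin N) : ∑ a, u i a = ∑ a, u j a := by
  calc ∑ a, u i a = (∑ a, u i a) * ((∑ a, u i a) * ∑ a, u j a) := by rw [h.sum_mul_sum, mul_one]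
    _ = ∑ a, u j a := by rw [← mul_assoc, h.sum_mul_sum, one_mul]

/-- A column sum times the common row sum `r` is a row sum of `u^t u = 1`, hence `1`. Since `r` is
its own inverse, every column sum equals `r`, so column sums and row sums coincide. -/
theorem IsBistoch.col_sum_eq (h : IsBistoch u) (i j : Fin N) : ∑ a, u a i = ∑ a, u j a := by
  have h1 : (∑ a, u a i) * ∑ b, u j b = 1 := by
    rw [Finset.sum_mul]
    calc ∑ a, u a i * ∑ b, u j b = ∑ a, u a i * ∑ b, u a b :=
          Finset.sum_congr rfl fun a _ => by rw [h.row_sum_eq j a]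
      _ = ∑ b, (uᵀ * u) i b := by
          simp only [Finset.mul_sum, Matrix.mul_apply, Matrix.transpose_apply]
          exact Finset.sum_comm
      _ = 1 := by simp [h.transpose_mul, Matrix.one_apply]
  calc ∑ a, u a i = (∑ a, u a i) * ((∑ a, u j a) * ∑ a, u j a) := by
        rw [h.sum_mul_sum, mul_one]
    _ = ∑ a, u j a := by rw [← mul_assoc, h1, one_mul]

end

/-- The entries of `J u` are column sums and those of `u J` are row sums, and these all agree. -/
theorem IsBistoch.projection_commutes {A : Type*} [Ring A] [Algebra ℂ A] [StarRing A] {n : ℕ}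
    {u : Matrix (Fin (n + 1)) (Fin (n + 1)) A} (h : IsBistoch u) (ε : ℤˣ) (hn : 1 ≤ n) :
    scal A ((Vmat ε n)ᴴ * Vmat ε n) * u = u * scal A ((Vmat ε n)ᴴ * Vmat ε n) := by
  rw [conjTranspose_mul_Vmat ε hn]
  set x : ℂ := 1 / (n + 1 : ℂ)
  have e : scal A ((1 : Matrix (Fin (n + 1)) (Fin (n + 1)) ℂ) - x • Matrix.of fun _ _ => 1) =
      1 - Matrix.of fun _ _ => algebraMap ℂ A x := by
    ext i j
    simp [scal, Matrix.one_apply, apply_ite (algebraMap ℂ A)]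
  rw [e, sub_mul, mul_sub, one_mul, mul_one]
  congr 1
  ext i j
  simp only [Matrix.mul_apply, Matrix.of_apply]
  rw [← Finset.mul_sum, ← Finset.sum_mul, Algebra.commutes, h.col_sum_eq j i]

theorem transpose_scal_mul {A : Type*} [Semiring A] [Algebra ℂ A] {ι κ μ : Type*} [Fintype κ]
    (M : Matrix ι κ ℂ) (u : Matrix κ μ A) : (scal A M * u)ᵀ = uᵀ * scal A Mᵀ := by
  ext i j
  simp only [Matrix.transpose_apply, Matrix.mul_apply, scal, Matrix.map_apply]
  exact Finset.sum_congr rfl fun _ _ => Algebra.commutes _ _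

theorem transpose_mul_scal {A : Type*} [Semiring A] [Algebra ℂ A] {ι κ μ : Type*} [Fintype κ]
    (u : Matrix ι κ A) (M : Matrix κ μ ℂ) : (u * scal A M)ᵀ = scal A Mᵀ * uᵀ := by
  ext i j
  simp only [Matrix.transpose_apply, Matrix.mul_apply, scal, Matrix.map_apply]
  exact Finset.sum_congr rfl fun _ _ => (Algebra.commutes _ _).symm

section

variable {A : Type u} [CStarAlgebra A] {n : ℕ} {u : Matrix (Fin (n + 1)) (Fin (n + 1)) A}

theorem corresponds_irr (h : IsBistoch u) (ε : ℤˣ) (hn : 1 ≤ n)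
    {K : ∀ k l : ℕ, Submodule ℂ (PLin k l)} (hK : Corresponds u K) :
    Corresponds (irr ε u) (calVCat ε n K) := by
  intro k l
  rw [irr, mor_restr, subRep, mor_compression u _ _ (Vmat_mul_conjTranspose ε hn)
    (h.projection_commutes ε hn), hK k l]
  ext S
  constructor
  · rintro ⟨_, ⟨p, hp, rfl⟩, rfl⟩
    exact ⟨_, ⟨p, hp, rfl⟩, T_calV ε n p⟩
  · rintro ⟨_, ⟨p, hp, rfl⟩, rfl⟩
    exact ⟨_, ⟨p, hp, rfl⟩, (T_calV ε n p).symm⟩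

theorem subRep_transpose (ε : ℤˣ) (u : Matrix (Fin (n + 1)) (Fin (n + 1)) A) :
    (subRep ε u)ᵀ = subRep ε uᵀ := by
  rw [subRep, subRep, transpose_mul_scal, transpose_scal_mul, Vmat_conjTranspose,
    Matrix.transpose_transpose, Matrix.mul_assoc]

/-- The inner `V^* V` commutes with `u` and disappears into the left `V`, which leaves `V (u w)
V^*`. -/
theorem IsBistoch.subRep_mul (h : IsBistoch u) (ε : ℤˣ) (hn : 1 ≤ n)
    (w : Matrix (Fin (n + 1)) (Fin (n + 1)) A) (hw : u * w = 1) :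
    subRep ε u * subRep ε w = 1 := by
  have e := h.projection_commutes ε hn
  have hV := Vmat_mul_conjTranspose ε hn
  rw [scal_mul] at e
  calc subRep ε u * subRep ε w
      = scal A (Vmat ε n) * (u * (scal A (Vmat ε n)ᴴ * scal A (Vmat ε n))) * w *
          scal A (Vmat ε n)ᴴ := by
        simp only [subRep, Matrix.mul_assoc]
    _ = scal A (Vmat ε n * (Vmat ε n)ᴴ) * scal A (Vmat ε n) * (u * w) * scal A (Vmat ε n)ᴴ := by
        rw [← e, scal_mul]; simp only [Matrix.mul_assoc]
    _ = 1 := by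
        rw [hV, hw, scal_one, Matrix.one_mul, Matrix.mul_one, ← scal_mul, hV, scal_one]

theorem IsBistoch.transpose (h : IsBistoch u) : IsBistoch uᵀ where
  star_apply i j := h.star_apply j i
  mul_transpose := h.transpose_mul
  transpose_mul := h.mul_transpose
  sum_mul_sum i j := by
    simp only [Matrix.transpose_apply]
    rw [h.col_sum_eq i i, h.col_sum_eq j i, h.sum_mul_sum]

theorem IsBistoch.subRep_mul_transpose (h : IsBistoch u) (ε : ℤˣ) (hn : 1 ≤ n) :
    subRep ε u * (subRep ε u)ᵀ = 1 := by
  rw [subRep_transpose]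
  exact h.subRep_mul ε hn _ h.mul_transpose

theorem IsBistoch.transpose_mul_subRep (h : IsBistoch u) (ε : ℤˣ) (hn : 1 ≤ n) :
    (subRep ε u)ᵀ * subRep ε u = 1 := by
  rw [subRep_transpose]
  exact h.transpose.subRep_mul ε hn _ h.transpose_mul

theorem subRep_apply (ε : ℤˣ) (u : Matrix (Fin (n + 1)) (Fin (n + 1)) A) (i j : Fin n) :
    subRep ε u i j = ∑ b, ∑ a, (Vmat ε n i a * Vmat ε n j b) • u a b := by
  rw [subRep, Vmat_conjTranspose]
  simp only [Matrix.mul_apply, Finset.sum_mul, scal, Matrix.map_apply, Matrix.transpose_apply]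
  refine Finset.sum_congr rfl fun b _ => Finset.sum_congr rfl fun a _ => ?_
  rw [mul_assoc, ← Algebra.commutes, ← mul_assoc, ← map_mul, Algebra.smul_def]

theorem IsBistoch.star_subRep (h : IsBistoch u) (ε : ℤˣ) (i j : Fin n) :
    star (subRep ε u i j) = subRep ε u i j := by
  simp only [subRep_apply, star_sum, star_smul, star_mul', star_Vmat, h.star_apply]

end

/-! ### Ranges of `*`-homomorphisms -/

theorem continuous_starAlgHom {A : Type*} {B : Type*} [CStarAlgebra A] [CStarAlgebra B]
    (φ : A →⋆ₐ[ℂ] B) : Continuous φ :=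
  AddMonoidHomClass.continuous_of_bound φ 1 fun a => by
    rw [one_mul]; exact NonUnitalStarAlgHom.norm_apply_le φ a

/-- Truncate `a` by functional calculus to the interval `[-‖φ a‖, ‖φ a‖]`. This interval contains
the spectrum of `φ a`, so the truncation does not change the image. -/
theorem exists_selfAdjoint_lift {A : Type*} {B : Type*} [CStarAlgebra A] [CStarAlgebra B]
    (φ : A →⋆ₐ[ℂ] B) {a : A} (ha : IsSelfAdjoint a) : ∃ a', φ a' = φ a ∧ ‖a'‖ ≤ ‖φ a‖ := by
  have hφa : IsSelfAdjoint (φ a) := ha.map φ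
  set r := ‖φ a‖
  have hr : 0 ≤ r := norm_nonneg _
  let f : ℝ → ℝ := fun t => max (-r) (min r t)
  have hf : Continuous f := by fun_prop
  refine ⟨cfc f a, ?_, ?_⟩
  · rw [StarAlgHom.map_cfc φ f a hf.continuousOn (continuous_starAlgHom φ) ha hφa]
    conv_rhs => rw [← cfc_id ℝ (φ a)]
    refine cfc_congr fun t ht => ?_
    have h1 : ‖t‖ ≤ r * ‖(1 : B)‖ := spectrum.norm_le_norm_mul_of_mem ht
    have h2 : ‖t‖ ≤ r := by
      rcases subsingleton_or_nontrivial B with hB | hB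
      · simp [spectrum.of_subsingleton] at ht
      · simpa using h1
    rw [Real.norm_eq_abs, abs_le] at h2
    simp [f, h2.1, h2.2]
  · refine norm_cfc_le hr fun t _ => ?_
    rw [Real.norm_eq_abs, abs_le]
    exact ⟨le_max_left _ _, max_le (by linarith) (min_le_left _ _)⟩

theorem exists_lift {A : Type*} {B : Type*} [CStarAlgebra A] [CStarAlgebra B]
    (φ : A →⋆ₐ[ℂ] B) (a : A) : ∃ a', φ a' = φ a ∧ ‖a'‖ ≤ 2 * ‖φ a‖ := by
  obtain ⟨x, hx, hx'⟩ := exists_selfAdjoint_lift φ (IsSelfAdjoint.add_star_self a)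
  -- The decomposition is `2a = (a + a^*) + i · i(a^* - a)`. Both self-adjoint parts have image of
  -- norm at most `2‖φ a‖`, and the half of their sum gives the constant `2`.
  have hy : IsSelfAdjoint (Complex.I • (star a - a)) := by
    rw [IsSelfAdjoint, star_smul, star_sub, star_star, Complex.star_def, Complex.conj_I, neg_smul,
      ← smul_neg, neg_sub]
  obtain ⟨y, hy, hy'⟩ := exists_selfAdjoint_lift φ hy
  refine ⟨(1 / 2 : ℂ) • (x + Complex.I • y), ?_, ?_⟩
  · rw [map_smul, map_add, map_smul, hx, hy, ← map_smul, ← map_add, ← map_smul]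
    congr 1
    rw [smul_smul, Complex.I_mul_I, neg_smul, one_smul, neg_sub, add_sub, add_sub_right_comm,
      add_sub_cancel_right, ← two_smul ℂ a, smul_smul]
    norm_num
  · have h1 : ‖x‖ ≤ 2 * ‖φ a‖ := by
      refine hx'.trans ?_
      rw [map_add, map_star]
      refine (norm_add_le _ _).trans ?_
      rw [norm_star]
      linarith
    have h2 : ‖y‖ ≤ 2 * ‖φ a‖ := by
      refine hy'.trans ?_
      rw [map_smul, norm_smul, Complex.norm_I, one_mul, map_sub, map_star]
      refine (norm_sub_le _ _).trans ?_
      rw [norm_star]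
      linarith
    have h3 : ‖x + Complex.I • y‖ ≤ ‖x‖ + ‖y‖ := by
      refine (norm_add_le _ _).trans ?_
      rw [norm_smul, Complex.norm_I, one_mul]
    rw [norm_smul]
    norm_num
    linarith

/-- The range of a `*`-homomorphism is closed: preimages of controlled norm on the range extend to
its closure by completeness of the domain. -/
theorem surjective_of_denseRange {A : Type*} {B : Type*} [CStarAlgebra A] [CStarAlgebra B]
    (φ : A →⋆ₐ[ℂ] B) (h : DenseRange φ) : Function.Surjective φ := by
  let f : NormedAddGroupHom A B := AddMonoidHom.mkNormedAddGroupHom (φ : A →+ B) 1 fun a => by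
    rw [one_mul]; exact NonUnitalStarAlgHom.norm_apply_le φ a
  have hf : ∀ a, f a = φ a := fun _ => rfl
  have h1 : f.SurjectiveOnWith f.range 2 := by
    rintro _ ⟨a, rfl⟩
    exact exists_lift φ a
  have h2 := controlled_closure_of_complete two_pos one_pos h1
  intro b
  obtain ⟨a, ha, -⟩ := h2 b (show b ∈ closure (Set.range φ) from h b)
  exact ⟨a, ha⟩

/-! ### C*-algebras generated by matrices -/

theorem map_mem_gen {A : Type*} {B : Type*} [CStarAlgebra A] [CStarAlgebra B] {N : ℕ}
    {u : Matrix (Fin N) (Fin N) A} {v : Matrix (Fin N) (Fin N) B} (φ : A →⋆ₐ[ℂ] B)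
    (h : ∀ i j, φ (u i j) = v i j) {a : A} (ha : a ∈ gen u) : φ a ∈ gen v := by
  have h1 := StarSubalgebra.map_topologicalClosure_le
    (StarAlgebra.adjoin ℂ (Set.range fun x : Fin N × Fin N => u x.1 x.2)) φ (continuous_starAlgHom φ)
  have h2 := h1 (StarSubalgebra.mem_map.2 ⟨a, ha, rfl⟩)
  rw [StarAlgHom.map_adjoin, ← Set.range_comp] at h2
  have e : (φ ∘ fun x : Fin N × Fin N => u x.1 x.2) = fun x => v x.1 x.2 := by
    funext x; exact h _ _
  rwa [e] at h2

theorem adjoin_le_range {A : Type*} {B : Type*} [CStarAlgebra A] [CStarAlgebra B] {N : ℕ}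
    {u : Matrix (Fin N) (Fin N) A} {v : Matrix (Fin N) (Fin N) B} (φ : A →⋆ₐ[ℂ] B)
    (h : ∀ i j, φ (u i j) = v i j) :
    StarAlgebra.adjoin ℂ (Set.range fun x : Fin N × Fin N => v x.1 x.2) ≤ φ.range := by
  refine StarAlgebra.adjoin_le ?_
  rintro _ ⟨x, rfl⟩
  exact ⟨u x.1 x.2, h _ _⟩

theorem surjective_of_gen_eq_top {A : Type*} {B : Type*} [CStarAlgebra A] [CStarAlgebra B] {N : ℕ}
    {u : Matrix (Fin N) (Fin N) A} {v : Matrix (Fin N) (Fin N) B} (hv : gen v = ⊤)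
    (φ : A →⋆ₐ[ℂ] B) (h : ∀ i j, φ (u i j) = v i j) : Function.Surjective φ := by
  refine surjective_of_denseRange φ fun b => ?_
  have hb : b ∈ gen v := hv ▸ StarSubalgebra.mem_top
  exact closure_mono (adjoin_le_range φ h) hb

theorem gen_restr {A : Type u} [CStarAlgebra A] {N : ℕ} (u : Matrix (Fin N) (Fin N) A) :
    gen (restr u) = ⊤ := by
  rw [eq_top_iff]
  rintro ⟨a, ha⟩ -
  change _ ∈ closure _
  rw [closure_subtype]
  have e : (StarAlgebra.adjoin ℂ (Set.range fun x : Fin N × Fin N => restr u x.1 x.2)).map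
      (gen u).subtype = StarAlgebra.adjoin ℂ (Set.range fun x : Fin N × Fin N => u x.1 x.2) := by
    rw [StarAlgHom.map_adjoin, ← Set.range_comp]
    rfl
  have e' := congrArg (fun S : StarSubalgebra ℂ A => (S : Set A)) e
  change a ∈ closure ((gen u).subtype '' _)
  rw [StarSubalgebra.coe_map] at e'
  rw [e']
  exact ha

theorem qsub_restr {A : Type u} {B : Type w} [CStarAlgebra A] [CStarAlgebra B] {N : ℕ}
    {u : Matrix (Fin N) (Fin N) A} {v : Matrix (Fin N) (Fin N) B} (φ : A →⋆ₐ[ℂ] B)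
    (h : ∀ i j, φ (u i j) = v i j) : QSub (restr v) (restr u) := by
  let ψ : gen u →⋆ₐ[ℂ] gen v :=
    (φ.comp (gen u).subtype).codRestrict (gen v) fun a => map_mem_gen φ h a.2
  have hψ : ∀ i j, ψ (restr u i j) = restr v i j := fun i j => Subtype.ext (h i j)
  exact ⟨ψ, surjective_of_gen_eq_top (gen_restr v) ψ hψ, hψ⟩

theorem map_subRep {A : Type u} {B : Type w} [CStarAlgebra A] [CStarAlgebra B] {n : ℕ} (ε : ℤˣ)
    {u : Matrix (Fin (n + 1)) (Fin (n + 1)) A} {v : Matrix (Fin (n + 1)) (Fin (n + 1)) B}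
    (φ : A →⋆ₐ[ℂ] B) (h : ∀ i j, φ (u i j) = v i j) (i j : Fin n) :
    φ (subRep ε u i j) = subRep ε v i j := by
  simp only [subRep_apply, map_sum, map_smul, h]

/-! ### Symmetric groups -/

/-- The point mass at `σ` is the product of the generators `u_{σ(j) j}`. -/
theorem gen_symm (n : ℕ) : gen (symm n) = ⊤ := by
  rw [eq_top_iff]
  intro f _
  have h1 : ∀ σ : Equiv.Perm (Fin n), (Pi.single σ 1 : Equiv.Perm (Fin n) → ℂ) ∈ gen (symm n) := by
    intro σ
    have : (Pi.single σ 1 : Equiv.Perm (Fin n) → ℂ) = ∏ j, symm n (σ j) j := by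
      funext τ
      rw [Finset.prod_apply]
      by_cases h : τ = σ
      · subst h
        simp [symm]
      · obtain ⟨j, hj⟩ := not_forall.1 (mt Equiv.ext h)
        rw [Pi.single_eq_of_ne h]
        exact (Finset.prod_eq_zero (Finset.mem_univ j) (if_neg (Ne.symm hj))).symm
    rw [this]
    exact prod_mem fun j _ => mem_gen _ _ _
  have : f = ∑ σ, f σ • (Pi.single σ 1 : Equiv.Perm (Fin n) → ℂ) := by
    funext τ
    simp [Finset.sum_apply, Pi.single_apply]
  rw [this]
  exact sum_mem fun σ _ => (gen (symm n)).smul_mem (h1 σ) _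

/-- The extension of a permutation of `Fin n` that fixes the last point. -/
def extPerm {n : ℕ} (σ : Equiv.Perm (Fin n)) : Equiv.Perm (Fin (n + 1)) :=
  (finSuccEquivLast.trans (Equiv.optionCongr σ)).trans finSuccEquivLast.symm

theorem extPerm_castSucc {n : ℕ} (σ : Equiv.Perm (Fin n)) (i : Fin n) :
    extPerm σ i.castSucc = (σ i).castSucc := by
  simp [extPerm]

theorem extPerm_last {n : ℕ} (σ : Equiv.Perm (Fin n)) : extPerm σ (Fin.last n) = Fin.last n := by
  simp [extPerm]

/-- Restriction of functions along a map. -/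
def pullback {α β : Type} [Fintype α] [Fintype β] (g : α → β) : (β → ℂ) →⋆ₐ[ℂ] (α → ℂ) where
  toFun f := f ∘ g
  map_one' := rfl
  map_mul' _ _ := rfl
  map_zero' := rfl
  map_add' _ _ := rfl
  commutes' _ := rfl
  map_star' _ := rfl

/-- On permutations that fix the last point, the entry is `δ_{i,σ(j)} + 2c + n c^2 + d^2`, and the
constant vanishes by `coeff_relation`. -/
theorem pullback_subRep_symm (ε : ℤˣ) {n : ℕ} (hn : 1 ≤ n) (i j : Fin n) :
    pullback extPerm (subRep ε (symm (n + 1)) i j) = symm n i j := by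
  have h := coeff_relation ε hn
  rw [subRep_apply]
  funext σ
  change (∑ b, ∑ a, (Vmat ε n i a * Vmat ε n j b) • symm (n + 1) a b) (extPerm σ) = _
  simp only [Finset.sum_apply, Pi.smul_apply, symm, Matrix.of_apply, smul_eq_mul, mul_ite, mul_one,
    mul_zero, Finset.sum_ite_eq', Finset.mem_univ, if_true]
  rw [Fin.sum_univ_castSucc]
  simp only [extPerm_castSucc, extPerm_last, Vmat_castSucc, Vmat_last, add_mul, mul_add,
    Finset.sum_add_distrib]
  have e : ∑ b, (if i = σ b then cCoeff ε n else 0) = cCoeff ε n := by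
    rw [← Equiv.sum_comp σ.symm]
    simp
  simp [e]
  linear_combination h

theorem qsub_symm_irr (ε : ℤˣ) {n : ℕ} (hn : 1 ≤ n) :
    QSub (symm n) (irr ε (symm (n + 1))) := by
  have h := pullback_subRep_symm ε hn
  let φ : gen (subRep ε (symm (n + 1))) →⋆ₐ[ℂ] (Equiv.Perm (Fin n) → ℂ) :=
    (pullback extPerm).comp (gen (subRep ε (symm (n + 1)))).subtype
  have hφ : ∀ i j, φ (irr ε (symm (n + 1)) i j) = symm n i j := h
  exact ⟨φ, surjective_of_gen_eq_top (gen_symm n) φ hφ, hφ⟩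

/-! ### Universal C*-algebras -/

/-- The representation of the universal C*-algebra given by a representation of the relations. -/
def evalHom {N : ℕ} {R : ∀ k l : ℕ, Set (PLin k l)} (ρ : OrthRep.{u} N R) :
    lp (fun ρ : OrthRep.{u} N R => ρ.carrier) ∞ →⋆ₐ[ℂ] ρ.carrier where
  toFun f := f ρ
  map_one' := rfl
  map_mul' _ _ := rfl
  map_zero' := rfl
  map_add' _ _ := rfl
  commutes' _ := rfl
  map_star' _ := rfl

theorem evalHom_univMat {N : ℕ} {R : ∀ k l : ℕ, Set (PLin k l)} (ρ : OrthRep.{u} N R)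
    (i j : Fin N) : evalHom ρ (univMat N R i j) = ρ.mat i j := rfl

theorem isBistoch_iff {A : Type*} [Semiring A] [StarRing A] {N : ℕ}
    {u : Matrix (Fin N) (Fin N) A} : IsBistoch u ↔
      (∀ i j, star (u i j) = u i j) ∧
      (∀ i j, ∑ k, u i k * u j k = if i = j then 1 else 0) ∧
      (∀ i j, ∑ k, u k i * u k j = if i = j then 1 else 0) ∧
      ∀ i j, (∑ a, u i a) * ∑ b, u j b = 1 := by
  constructor
  · intro h
    refine ⟨h.1, fun i j => ?_, fun i j => ?_, h.4⟩
    · simpa [Matrix.mul_apply, Matrix.one_apply] using congrFun (congrFun h.2 i) j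
    · simpa [Matrix.mul_apply, Matrix.one_apply] using congrFun (congrFun h.3 i) j
  · rintro ⟨h1, h2, h3, h4⟩
    refine ⟨h1, ?_, ?_, h4⟩
    · ext i j
      simpa [Matrix.mul_apply, Matrix.one_apply] using h2 i j
    · ext i j
      simpa [Matrix.mul_apply, Matrix.one_apply] using h3 i j

theorem IsBistoch.map {A B : Type*} [CStarAlgebra A] [CStarAlgebra B] {N : ℕ}
    {u : Matrix (Fin N) (Fin N) A} {v : Matrix (Fin N) (Fin N) B} (h : IsBistoch u)
    (φ : A →⋆ₐ[ℂ] B) (hφ : ∀ i j, φ (u i j) = v i j) : IsBistoch v := by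
  rw [isBistoch_iff] at h ⊢
  obtain ⟨h1, h2, h3, h4⟩ := h
  simp only [← hφ, ← map_star, ← map_mul, ← map_sum, h1, h2, h3, h4, apply_ite φ, map_one, map_zero,
    implies_true, and_self]

theorem isBistoch_of_forall_map {ι : Type*} {A : Type*} {B : ι → Type*} [CStarAlgebra A]
    [∀ x, CStarAlgebra (B x)] {N : ℕ} {u : Matrix (Fin N) (Fin N) A}
    (φ : ∀ x, A →⋆ₐ[ℂ] B x) (hinj : ∀ a b, (∀ x, φ x a = φ x b) → a = b)
    (h : ∀ x, IsBistoch (Matrix.of fun i j => φ x (u i j))) : IsBistoch u := by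
  simp only [isBistoch_iff, Matrix.of_apply] at h ⊢
  refine ⟨fun i j => hinj _ _ fun x => ?_, fun i j => hinj _ _ fun x => ?_,
    fun i j => hinj _ _ fun x => ?_, fun i j => hinj _ _ fun x => ?_⟩
  · rw [map_star, (h x).1]
  · simp only [map_sum, map_mul, (h x).2.1, apply_ite (φ x), map_one, map_zero]
  · simp only [map_sum, map_mul, (h x).2.2.1, apply_ite (φ x), map_one, map_zero]
  · simp only [map_sum, map_mul, (h x).2.2.2, map_one]

/-- The double singleton is sent to the all-ones vector; the component `(i, j)` of its invariance
says that the product of the row sums `i` and `j` is `1`. -/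
theorem isBistoch_orthRep {N : ℕ} (ρ : OrthRep.{u} N fun k l => {p | DoubleSingletonOnly k l p}) :
    IsBistoch ρ.mat := by
  refine ⟨ρ.star_mat, ρ.mul_transpose, ρ.transpose_mul, fun i j => ?_⟩
  have h := ρ.rel 0 2 doubleSingleton .mk
  rw [Mor, Set.mem_ofPred_eq] at h
  have h1 : T N doubleSingleton = Matrix.of fun _ _ => 1 := by
    ext j i
    have : Compat (⊥ : Part 0 2) (Sum.elim i j) := by
      rintro x y rfl; rfl
    simp [doubleSingleton, T_single, partMatrix_apply, this]
  have h2 := congrFun (congrFun h ![i, j]) default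
  rw [h1, Matrix.mul_apply, Matrix.mul_apply,
    ← (finTwoArrowEquiv (Fin N)).symm.sum_comp, Fintype.sum_prod_type] at h2
  rw [Finset.sum_mul_sum]
  simpa [scal, tpow_zero, tpow_succ, Fin.tail, finTwoArrowEquiv] using h2.symm

theorem isBistoch_univRep (N : ℕ) : IsBistoch (bistochSharp.{u} N) := by
  refine isBistoch_of_forall_map (fun ρ => (evalHom ρ).comp (gen (univMat.{u} N _)).subtype)
    (fun a b hab => ?_) fun ρ => isBistoch_orthRep ρ
  refine Subtype.ext (lp.ext ?_)
  funext ρ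
  exact hab ρ

theorem isBistoch_of_qsub {A : Type u} [CStarAlgebra A] {N : ℕ} {u : Matrix (Fin N) (Fin N) A}
    (h : QSub u (bistochSharp.{u} N)) : IsBistoch u := by
  obtain ⟨φ, -, hφ⟩ := h
  exact (isBistoch_univRep N).map φ hφ

/-! ### `G^irr` as a compact matrix quantum group -/

section

variable {A : Type u} [CStarAlgebra A] {n : ℕ} {u : Matrix (Fin (n + 1)) (Fin (n + 1)) A}

theorem qsub_irr_freeOrth [Nontrivial A] (h : IsBistoch u) (ε : ℤˣ) (hn : 1 ≤ n) :
    QSub (irr ε u) (freeOrth.{u} n) := by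
  let ρ : OrthRep.{u} n fun _ _ => ∅ :=
    { carrier := A
      mat := subRep ε u
      star_mat := h.star_subRep ε
      mul_transpose := h.subRep_mul_transpose ε hn
      transpose_mul := h.transpose_mul_subRep ε hn
      rel := fun _ _ _ hp => hp.elim }
  exact qsub_restr (evalHom ρ) (evalHom_univMat ρ)

theorem irr_mul_transpose (h : IsBistoch u) (ε : ℤˣ) (hn : 1 ≤ n) :
    irr ε u * (irr ε u)ᵀ = 1 := by
  ext i j
  have := congrFun (congrFun (h.subRep_mul_transpose ε hn) i) j
  rw [Matrix.mul_apply] at this ⊢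
  push_cast
  refine this.trans ?_
  rw [Matrix.one_apply, Matrix.one_apply]
  split_ifs <;> rfl

theorem transpose_mul_irr (h : IsBistoch u) (ε : ℤˣ) (hn : 1 ≤ n) :
    (irr ε u)ᵀ * irr ε u = 1 := by
  ext i j
  have := congrFun (congrFun (h.transpose_mul_subRep ε hn) i) j
  rw [Matrix.mul_apply] at this ⊢
  push_cast
  refine this.trans ?_
  rw [Matrix.one_apply, Matrix.one_apply]
  split_ifs <;> rfl

/-- The row sums of `u` agree and the rows of `V` sum to zero. This kills the `J`-part of `V^* V` in
the comultiplication. -/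
theorem IsBistoch.sum_smul_apply (h : IsBistoch u) (ε : ℤˣ) (hn : 1 ≤ n) (i : Fin n) :
    ∑ c, ∑ a, Vmat ε n i a • u a c = 0 := by
  rw [Finset.sum_comm]
  simp only [← Finset.smul_sum]
  calc ∑ a, Vmat ε n i a • ∑ c, u a c = ∑ a, Vmat ε n i a • ∑ c, u 0 c :=
        Finset.sum_congr rfl fun a _ => by rw [h.row_sum_eq a 0]
    _ = 0 := by rw [← Finset.sum_smul, Vmat_sum ε hn, zero_smul]

/-- The sum over the subrepresentation in the comultiplication, for elementary tensors. -/
theorem sum_tmul_Vmat {H : Type*} [AddCommGroup H] [Module ℂ H] (ε : ℤˣ) (hn : 1 ≤ n)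
    (X Y : Fin (n + 1) → H) (hX : ∑ c, X c = 0) :
    ∑ k, (∑ c, Vmat ε n k c • X c) ⊗ₜ[ℂ] (∑ c, Vmat ε n k c • Y c) = ∑ c, X c ⊗ₜ[ℂ] Y c := by
  have hP := conjTranspose_mul_Vmat ε hn
  rw [Vmat_conjTranspose] at hP
  have hP' : ∀ c c', ∑ k, Vmat ε n k c * Vmat ε n k c' =
      (if c = c' then 1 else 0) - 1 / (n + 1 : ℂ) := by
    intro c c'
    simpa [Matrix.mul_apply, Matrix.one_apply] using congrFun (congrFun hP c) c'
  simp only [TensorProduct.sum_tmul, TensorProduct.tmul_sum, TensorProduct.smul_tmul_smul]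
  rw [Finset.sum_comm]
  simp only [Finset.sum_comm (s := (Finset.univ : Finset (Fin n))), ← Finset.sum_smul, hP', sub_smul,
    Finset.sum_sub_distrib, ite_smul, one_smul, zero_smul, Finset.sum_ite_eq', Finset.mem_univ,
    if_true]
  -- The `J/N` summand of `V^* V` separates into `(∑ X) ⊗ (∑ Y)`, which is zero.
  have : ∑ c, ∑ c', (1 / (n + 1 : ℂ)) • (X c ⊗ₜ[ℂ] Y c') = 0 := by
    simp only [← Finset.smul_sum, ← TensorProduct.tmul_sum, ← TensorProduct.sum_tmul, hX,
      TensorProduct.zero_tmul, smul_zero]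
  rw [Finset.sum_comm] at this
  rw [this, sub_zero]

/-- The representation and the comultiplication of `G` are restricted to the subalgebra. In `∑_k
v_{ik} ⊗ v_{kj}` the sum over `k` creates `V^* V` between the two legs, and `sum_tmul_Vmat` replaces
it by the identity. -/
theorem isCMQG_irr (hG : IsCMQG u) (h : IsBistoch u) (ε : ℤˣ) (hn : 1 ≤ n) :
    IsCMQG (irr ε u) := by
  have e1 := irr_mul_transpose h ε hn
  have e2 := transpose_mul_irr h ε hn
  refine ⟨gen_restr _, ⟨⟨_, _, e1, e2⟩, rfl⟩, ⟨⟨_, _, e2, e1⟩, rfl⟩, ?_⟩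
  obtain ⟨H, i1, i2, i3, π, Δ, hπ, hΔ⟩ := hG.comul
  refine ⟨H, i1, i2, i3, π.comp (gen (subRep ε u)).subtype, Δ.comp (gen (subRep ε u)).subtype,
    hπ.comp Subtype.val_injective, fun i j x y => ?_⟩
  change Δ (subRep ε u i j) _ = ((∑ k, (π (subRep ε u i k) x) ⊗ₜ[ℂ] (π (subRep ε u k j) y) :
    H ⊗[ℂ] H) : Hilb2 H)
  let L : H ⊗[ℂ] H →L[ℂ] Hilb2 H := UniformSpace.Completion.toComplL
  have hL : ∀ t : H ⊗[ℂ] H, (t : Hilb2 H) = L t := fun _ => rfl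
  simp only [hL] at hΔ ⊢
  have eX : ∀ k, π (subRep ε u i k) x =
      ∑ c, Vmat ε n k c • ∑ a, Vmat ε n i a • π (u a c) x := by
    intro k
    simp only [subRep_apply, map_sum, map_smul, _root_.sum_apply,
      _root_.smul_apply, Finset.smul_sum, smul_smul, mul_comm]
  have eY : ∀ k, π (subRep ε u k j) y =
      ∑ c, Vmat ε n k c • ∑ b, Vmat ε n j b • π (u c b) y := by
    intro k
    rw [subRep_apply, Finset.sum_comm]
    simp only [map_sum, map_smul, _root_.sum_apply,
      _root_.smul_apply, Finset.smul_sum, smul_smul]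
  have hX : ∑ c, ∑ a, Vmat ε n i a • π (u a c) x = 0 := by
    have := congrArg (fun a => π a x) (h.sum_smul_apply ε hn i)
    simpa only [map_sum, map_smul, _root_.sum_apply,
      _root_.smul_apply, map_zero, _root_.zero_apply] using this
  simp only [eX, eY]
  rw [sum_tmul_Vmat ε hn _ _ hX, subRep_apply]
  simp only [map_sum, map_smul, _root_.sum_apply, _root_.smul_apply, hΔ,
    TensorProduct.sum_tmul, TensorProduct.tmul_sum, TensorProduct.smul_tmul_smul, Finset.smul_sum]
  conv_rhs => rw [Finset.sum_comm]
  exact Finset.sum_congr rfl fun b _ => Finset.sum_comm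

end

end PartQG

end

theorem theoremA {A : Type u} [CStarAlgebra A] (n : ℕ) (hn : 1 ≤ n) (ε : ℤˣ)
    (u : Matrix (Fin (n + 1)) (Fin (n + 1)) A)
    (hG : PartQG.IsCMQG u)
    (hSG : PartQG.QSub (PartQG.symm (n + 1)) u)
    (hGB : PartQG.QSub u (PartQG.bistochSharp.{u} (n + 1))) :
    PartQG.IsCMQG (PartQG.irr ε u) ∧
    PartQG.QSub (PartQG.symm n) (PartQG.irr ε (PartQG.symm (n + 1))) ∧
    PartQG.QSub (PartQG.irr ε (PartQG.symm (n + 1))) (PartQG.irr ε u) ∧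
    PartQG.QSub (PartQG.irr ε u) (PartQG.freeOrth.{u} n) ∧
    (∀ (k l : ℕ) (p : PartQG.PLin k l),
      PartQG.T n (PartQG.calV ε n p) =
        PartQG.tpow (PartQG.Vmat ε n) l * PartQG.T (n + 1) p *
          PartQG.tpow (PartQG.Vmat ε n)ᴴ k) ∧
    (∀ K : ∀ k l : ℕ, Submodule ℂ (PartQG.PLin k l),
      PartQG.IsLinCat (n + 1) K → PartQG.doubleSingleton ∈ K 0 2 → PartQG.Corresponds u K →
        PartQG.IsLinCat n (PartQG.calVCat ε n K) ∧
          PartQG.Corresponds (PartQG.irr ε u) (PartQG.calVCat ε n K)) := by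
  have h := PartQG.isBistoch_of_qsub hGB
  obtain ⟨φ, -, hφ⟩ := hSG
  -- `A` maps to the nonzero algebra of functions on `S_N`. Nontriviality is needed because
  -- `OrthRep` admits only nonzero algebras.
  have hA : Nontrivial A := φ.toRingHom.domain_nontrivial
  exact ⟨PartQG.isCMQG_irr hG h ε hn, PartQG.qsub_symm_irr ε hn,
    PartQG.qsub_restr φ (PartQG.map_subRep ε φ hφ), PartQG.qsub_irr_freeOrth h ε hn,
    fun _ _ p => PartQG.T_calV ε n p,
    fun K hK hS hC => ⟨PartQG.isLinCat_calVCat ε hn hK hS, PartQG.corresponds_irr h ε hn hC⟩⟩
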